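/- **Setting.** Let $S_0$ be a fixed sphere with centre $O$ and radius $R$, let $B_1,\dots,B_n$ be balls of the same radius $r$, with masses $m_i>0$ and inertia operators $I_i\,\mathrm{Id}$, $I_i>0$, that roll without slipping on $S_0$ at the points $A_i$, and let $S$ be a sphere, whose centre is kept at $O$, with inertia operator $\mathbb I=\mathrm{diag}(A,B,C)$, $A,B,C>0$, that rolls without slipping on the balls at the points $B_i$. Four configurations are considered; the upper sign belongs to I and III, the lower sign to II and IV. (I) The balls are outside $S_0$ and inside $S$; $S$ has radius $R+2r$. (II) The balls are inside $S_0$ and outside $S$; $S$ has radius $R-2r>0$. (III) $n=1$, $B_1$ is a shell inside $S$ that contains $S_0$; $S$ has radius $2r-R>R$. (IV) $n=1$, $B_1$ is a shell inside $S_0$ that contains $S$; $S$ has radius $2r-R$, $0<2r-R<R$. Let $O_i$ be the centre of $B_i$, and $\vec\gamma_i=\overrightarrow{OO_i}/|\overrightarrow{OO_i}|$. The configuration space is $Q=SO(3)^{n+1}\times(S^2)^n\ni(g,g_1,\dots,g_n,\vec\gamma_1,\dots,\vec\gamma_n)$, where $g,g_i$ map the frames attached to $S,B_i$ to the fixed frame.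 (The inequalities that express that distinct balls do not overlap are not imposed.) Identify $\mathbb R^3$ with $so(3)$ by $a_{ij}=-\varepsilon_{ijk}a_k$; let $\vec\omega,\vec\omega_i$ be the vectors of $\dot gg^{-1}$, $\dot g_ig_i^{-1}$, let $\vec\Omega=g^{-1}\vec\omega$, $\vec\Omega_i=g^{-1}\vec\omega_i$, $\vec\Gamma_i=g^{-1}\vec\gamma_i$, and let $\vec v_{O_i}=|OO_i|\,\dot{\vec\gamma}_i$, where $|OO_i|$ is $R+r$, $R-r$, $r-R$, $R-r$ in the cases I, II, III, IV. The kinetic energy is $T=\frac12\langle\mathbb I\vec\Omega,\vec\Omega\rangle+\frac12\sum I_i\langle\vec\omega_i,\vec\omega_i\rangle+\frac12\sum m_i\langle\vec v_{O_i},\vec v_{O_i}\rangle$. The rolling constraints $\vec v_{O_i}+\vec\omega_i\times\overrightarrow{O_iA_i}=0$, $\vec v_{O_i}+\vec\omega_i\times\overrightarrow{O_iB_i}=\vec\omega\times\overrightarrow{OB_i}$ with $\overrightarrow{O_iA_i}=\mp r\vec\gamma_i$, $\overrightarrow{O_iB_i}=\pm r\vec\gamma_i$ define the distribution $\mathcal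 D\subset TQ$. The motions are the twice differentiable curves in $Q$ with velocity in $\mathcal D$ that satisfy the Lagrange–d'Alembert equations $\big(\frac{\partial T}{\partial q}-\frac{d}{dt}\frac{\partial T}{\partial\dot q},\delta q\big)=0$ for all $\delta q\in\mathcal D_q$. For $c\in\mathbb R^n$ let $\mathcal D_c=\{\langle\vec\omega_i,\vec\gamma_i\rangle=c_i,\ i=1,\dots,n\}\subset\mathcal D$. Put $$\varepsilon=\frac{R}{2R\pm2r},\ \ \delta=\pm\frac{R\pm2r}{2r}\ \ (\text{I, II}),\qquad \varepsilon=\frac{R}{2R-2r},\ \ \delta=\frac{2r-R}{2r}\ \ (\text{III, IV}),$$ $$\vec M=\mathbb I\vec\Omega+\delta^2\sum_{i=1}^n(I_i+m_ir^2)\big(\vec\Omega-\langle\vec\Gamma_i,\vec\Omega\rangle\vec\Gamma_i\big),\qquad \vec N=\delta\sum_{i=1}^nI_ic_i\vec\Gamma_i .$$ **Theorem.** Every motion that starts in $\mathcal D_c$ stays in $\mathcal D_c$. (i) $(\vec\Omega,g,g_1,\dots,g_n,\vec\Gamma_1,\dots,\vec\Gamma_n)$ defines a diffeomorphism $\mathcal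 D_c\cong\mathbb R^3\times SO(3)^{n+1}\times(S^2)^n$, and in these coordinates the motions in $\mathcal D_c$ are exactly the solutions of $$\dot{\vec M}=\vec M\times\vec\Omega+(1-\varepsilon)\vec N\times\vec\Omega,\qquad(1)$$ $$\dot{\vec\Gamma}_i=\varepsilon\,\vec\Gamma_i\times\vec\Omega,\qquad i=1,\dots,n,\qquad(2)$$ $$\dot g=g\,\Omega,\qquad \dot g_i=g\,\Omega_i\,g^{-1}g_i,\qquad i=1,\dots,n,$$ where $\Omega$ and $\Omega_i$ are the skew-symmetric matrices of $\vec\Omega$ and of $\vec\Omega_i=c_i\vec\Gamma_i+\delta\vec\Omega-\delta\langle\vec\Gamma_i,\vec\Omega\rangle\vec\Gamma_i$. (ii) Let $SO(3)^{n+1}$ act on $TQ$ by the lift of $(g,g_i,\vec\gamma_i)\mapsto(ag,\,ag_ia_i^{-1},\,a\vec\gamma_i)$. Then $\mathcal D_c$ is invariant, and $(TQ)/SO(3)^{n+1}$ is identified with $\mathbb R^{3(n+1)}\times(TS^2)^n$ by $(\vec\Omega,\vec\Omega_i,\dot{\vec\Gamma}_i,\vec\Gamma_i)$. The projection $(\vec\Omega,\vec\Omega_i,\dot{\vec\Gamma}_i,\vec\Gamma_i)\mapsto(\vec\Omega,\vec\Gamma_i)$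 restricts to a diffeomorphism of $\mathcal M_c=\mathcal D_c/SO(3)^{n+1}$ onto $\mathcal N=\mathbb R^3\times(S^2)^n$. The projections to $\mathcal M_c\cong\mathcal N$ of the motions in $\mathcal D_c$ are exactly the solutions of (1), (2), and (1), (2) is a closed system: it is the system of differential equations of a smooth vector field on $\mathcal N$. -/

import Mathlib

open scoped Matrix ContDiff

-- Topology and differentiation on real matrices (all norms on them are equivalent).
attribute [local instance] Matrix.normedAddCommGroup Matrix.normedSpace

namespace BallBearing

noncomputable section

/-! ### Vectors, rotations, spheres -/

/-- Vectors of Euclidean 3-space; the scalar product is `⬝ᵥ`, the vector product `⨯₃`. -/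
abbrev V3 : Type := Fin 3 → ℝ

/-- Real 3 × 3 matrices. -/
abbrev M3 : Type := Matrix (Fin 3) (Fin 3) ℝ

/-- The rotation group. On it the inverse of a matrix is its transpose. -/
def SO3 : Set M3 := (Matrix.specialOrthogonalGroup (Fin 3) ℝ : Set M3)

/-- The unit sphere of Euclidean 3-space. -/
def S2 : Set V3 := {x | x ⬝ᵥ x = 1}

/-- The isomorphism from `(ℝ³, ×)` to `so(3)`: `a_{ij} = - ε_{ijk} a_k`. -/
def hat (a : V3) : M3 :=
  !![0, -a 2, a 1; a 2, 0, -a 0; -a 1, a 0, 0]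

/-- The vector of the skew-symmetric part of a matrix; the inverse of `hat` on `so(3)`. -/
def vee (X : M3) : V3 :=
  ![(X 2 1 - X 1 2) / 2, (X 0 2 - X 2 0) / 2, (X 1 0 - X 0 1) / 2]

theorem vee_hat (a : V3) : vee (hat a) = a := by
  funext k
  fin_cases k <;> simp [vee, hat]

theorem hat_vee (X : M3) (hX : Xᵀ = -X) : hat (vee X) = X := by
  have h (i j : Fin 3) : X j i = -X i j := congrFun (congrFun hX i) j
  have h0 := h 0 0
  have h1 := h 1 1
  have h2 := h 2 2
  have h01 := h 0 1
  have h02 := h 0 2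
  have h12 := h 1 2
  ext i j
  fin_cases i <;> fin_cases j <;> simp [vee, hat] <;> linarith

theorem hat_mulVec (a b : V3) : hat a *ᵥ b = a ⨯₃ b := by
  funext k
  fin_cases k <;> simp [hat, crossProduct, Matrix.mulVec, dotProduct, Fin.sum_univ_three] <;> ring

/-! ### The mechanical system -/

/-- The four configurations of the spherical ball bearing. -/
inductive Kind where
  | I | II | III | IV

/-- The radii `R` of the fixed sphere `S₀` and `r` of the `n` balls that each configuration allows
(the radius `R + 2r`, `R - 2r`, `2r - R`, `2r - R` of the moving sphere has to be positive):
I: the balls are outside `S₀` and inside the moving sphere `S`;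
II: the balls are inside `S₀` and outside `S`;
III: one spherical shell, `S₀` inside it, and it is inside `S`;
IV: one spherical shell, it is inside `S₀`, and `S` is inside it. -/
def Kind.Admissible : Kind → ℕ → ℝ → ℝ → Prop
  | .I, _, R, r => 0 < R ∧ 0 < r
  | .II, _, R, r => 0 < r ∧ 2 * r < R
  | .III, n, R, r => n = 1 ∧ 0 < R ∧ R < r
  | .IV, n, R, r => n = 1 ∧ R < 2 * r ∧ r < R

/-- The data of a spherical ball bearing with `n` balls: the configuration, the radii `R` (fixed
sphere) and `r` (balls), the principal moments of inertia of the moving sphere `S`, and the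
moments of inertia and masses of the balls. -/
structure Bearing (n : ℕ) where
  kind : Kind
  R : ℝ
  r : ℝ
  inertia : Fin 3 → ℝ
  ballInertia : Fin n → ℝ
  mass : Fin n → ℝ
  admissible : kind.Admissible n R r
  inertia_pos : ∀ k, 0 < inertia k
  ballInertia_pos : ∀ i, 0 < ballInertia i
  mass_pos : ∀ i, 0 < mass i

variable {n : ℕ}

/-- The distance `|OOᵢ|` of the centre of a ball from the common centre `O` of `S₀` and `S`. -/
def Bearing.dist (B : Bearing n) : ℝ :=
  match B.kind with
  | .I => B.R + B.r
  | .II => B.R - B.r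
  | .III => B.r - B.R
  | .IV => B.R - B.r

/-- The position along `γᵢ` of the contact point `Aᵢ` with `S₀`: the vector `OᵢAᵢ` is this number
times `γᵢ`. -/
def Bearing.contactA (B : Bearing n) : ℝ :=
  match B.kind with
  | .I => -B.r
  | .II => B.r
  | .III => -B.r
  | .IV => B.r

/-- The position along `γᵢ` of the contact point `Bᵢ` with `S`: the vector `OᵢBᵢ` is this number
times `γᵢ`. -/
def Bearing.contactB (B : Bearing n) : ℝ :=
  match B.kind with
  | .I => B.r
  | .II => -B.r
  | .III => B.r
  | .IV => -B.r

/-- The parameter `ε`. -/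
def Bearing.eps (B : Bearing n) : ℝ :=
  match B.kind with
  | .I => B.R / (2 * B.R + 2 * B.r)
  | .II => B.R / (2 * B.R - 2 * B.r)
  | .III => B.R / (2 * B.R - 2 * B.r)
  | .IV => B.R / (2 * B.R - 2 * B.r)

/-- The parameter `δ`. -/
def Bearing.delta (B : Bearing n) : ℝ :=
  match B.kind with
  | .I => (B.R + 2 * B.r) / (2 * B.r)
  | .II => -((B.R - 2 * B.r) / (2 * B.r))
  | .III => (2 * B.r - B.R) / (2 * B.r)
  | .IV => (2 * B.r - B.R) / (2 * B.r)

/-! ### Configurations and velocities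

Points of `Q = SO(3)^{n+1} × (S²)ⁿ` and tangent vectors of `Q` are written in the ambient vector
space of all triples `(g, (gᵢ), (γᵢ))`. -/

/-- The vector space that contains the configuration space. -/
abbrev Conf (n : ℕ) : Type := M3 × (Fin n → M3) × (Fin n → V3)

/-- The configuration space `Q = SO(3)^{n+1} × (S²)ⁿ`. -/
def Q (n : ℕ) : Set (Conf n) :=
  {q | q.1 ∈ SO3 ∧ (∀ i, q.2.1 i ∈ SO3) ∧ ∀ i, q.2.2 i ∈ S2}

/-- The tangent space of `Q` at `q`. -/
def tangentQ (q : Conf n) : Set (Conf n) :=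
  {v | (q.1ᵀ * v.1)ᵀ = -(q.1ᵀ * v.1) ∧
    (∀ i, ((q.2.1 i)ᵀ * v.2.1 i)ᵀ = -((q.2.1 i)ᵀ * v.2.1 i)) ∧
    ∀ i, q.2.2 i ⬝ᵥ v.2.2 i = 0}

/-- The tangent bundle `TQ`, as a set of pairs (position, velocity). -/
def TQ (n : ℕ) : Set (Conf n × Conf n) :=
  {x | x.1 ∈ Q n ∧ x.2 ∈ tangentQ x.1}

/-- The angular velocity `ω` of `S` in the fixed frame. -/
def angVel (q v : Conf n) : V3 := vee (v.1 * q.1ᵀ)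

/-- The angular velocity `Ω` of `S` in the moving frame. -/
def bodyAngVel (q v : Conf n) : V3 := vee (q.1ᵀ * v.1)

/-- The angular velocity `ωᵢ` of the `i`-th ball in the fixed frame. -/
def ballAngVel (q v : Conf n) (i : Fin n) : V3 := vee (v.2.1 i * (q.2.1 i)ᵀ)

/-- The velocity of the centre `Oᵢ` of the `i`-th ball in the fixed frame. -/
def Bearing.centreVel (B : Bearing n) (v : Conf n) (i : Fin n) : V3 := B.dist • v.2.2 i

/-- The kinetic energy. -/
def Bearing.energy (B : Bearing n) (q v : Conf n) : ℝ :=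
  (1 / 2) * ∑ k, B.inertia k * bodyAngVel q v k ^ 2
    + (1 / 2) * ∑ i, B.ballInertia i * (ballAngVel q v i ⬝ᵥ ballAngVel q v i)
    + (1 / 2) * ∑ i, B.mass i * (B.centreVel v i ⬝ᵥ B.centreVel v i)

/-- The nonholonomic distribution at `q`: the velocities for which the balls roll without slipping
over `S₀` (at `Aᵢ`) and over `S` (at `Bᵢ`). -/
def Bearing.distribution (B : Bearing n) (q : Conf n) : Set (Conf n) :=
  {v | v ∈ tangentQ q ∧ ∀ i,
    B.centreVel v i + ballAngVel q v i ⨯₃ (B.contactA • q.2.2 i) = 0 ∧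
    B.centreVel v i + ballAngVel q v i ⨯₃ (B.contactB • q.2.2 i) =
      angVel q v ⨯₃ ((B.dist + B.contactB) • q.2.2 i)}

/-- The phase space `𝒟 ⊂ TQ`. -/
def Bearing.phase (B : Bearing n) : Set (Conf n × Conf n) :=
  {x | x.1 ∈ Q n ∧ x.2 ∈ B.distribution x.1}

/-- The submanifold `𝒟_c` of the phase space: `⟨ωᵢ, γᵢ⟩ = cᵢ`. -/
def Bearing.phaseC (B : Bearing n) (c : Fin n → ℝ) : Set (Conf n × Conf n) :=
  {x | x ∈ B.phase ∧ ∀ i, ballAngVel x.1 x.2 i ⬝ᵥ x.1.2.2 i = c i}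

/-! ### The Lagrange–d'Alembert equations -/

/-- `⟨d/dt ∂L/∂q̇ - ∂L/∂q, w⟩` along the curve `q` at the time `t`, in the linear coordinates of the
vector space `E`. For a curve in a submanifold of `E` and `w` tangent to it, this is the pairing
with the Euler-Lagrange covector of the submanifold; it depends only on the values of `L` at tangent
vectors of the submanifold. -/
def eulerLagrange {E : Type*} [NormedAddCommGroup E] [NormedSpace ℝ E] (L : E → E → ℝ)
    (q : ℝ → E) (t : ℝ) (w : E) : ℝ :=
  deriv (fun s => lineDeriv ℝ (fun v => L (q s) v) (deriv q s) w) t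
    - lineDeriv ℝ (fun p => L p (deriv q t)) (q t) w

/-- `q` is a motion of the bearing during the open time interval `J`: a twice differentiable curve
in `Q` that satisfies the constraints and the Lagrange–d'Alembert equations for all virtual
displacements `w` in the distribution. -/
def Bearing.IsMotion (B : Bearing n) (J : Set ℝ) (q : ℝ → Conf n) : Prop :=
  ∀ t ∈ J, DifferentiableAt ℝ q t ∧ DifferentiableAt ℝ (deriv q) t ∧
    (q t, deriv q t) ∈ B.phase ∧
    ∀ w ∈ B.distribution (q t), eulerLagrange B.energy q t w = 0

/-! ### The equations of the theorem -/

/-- `Ωᵢ` as a function of `Ω`, `Γᵢ` and `cᵢ`. -/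
def Bearing.ballOmega (B : Bearing n) (c : Fin n → ℝ) (Ω : V3) (Γ : Fin n → V3) (i : Fin n) : V3 :=
  c i • Γ i + B.delta • Ω - (B.delta * (Γ i ⬝ᵥ Ω)) • Γ i

/-- `M = 𝐈 Ω`, with the modified operator of inertia
`𝐈 = diag(A, B, C) + δ² ∑ (Iᵢ + mᵢ r²) prᵢ`, `prᵢ` the orthogonal projection to `Γᵢ^⊥`. -/
def Bearing.momentum (B : Bearing n) (Ω : V3) (Γ : Fin n → V3) : V3 :=
  (fun k => B.inertia k * Ω k)
    + B.delta ^ 2 • ∑ i, (B.ballInertia i + B.mass i * B.r ^ 2) • (Ω - (Γ i ⬝ᵥ Ω) • Γ i)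

/-- `N = δ ∑ Iᵢ cᵢ Γᵢ`. -/
def Bearing.gyro (B : Bearing n) (c : Fin n → ℝ) (Γ : Fin n → V3) : V3 :=
  B.delta • ∑ i, (B.ballInertia i * c i) • Γ i

/-- The vector space of the pairs `(Ω, (Γᵢ))`. -/
abbrev Red (n : ℕ) : Type := V3 × (Fin n → V3)

/-- The second reduced phase space `𝒩 = ℝ³ × (S²)ⁿ`. -/
def redSpace (n : ℕ) : Set (Red n) := {y | ∀ i, y.2 i ∈ S2}

/-- The closed system: `Ṁ = M × Ω + (1 - ε) N × Ω`, `Γ̇ᵢ = ε Γᵢ × Ω` for the curve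
`y = (Ω, (Γᵢ))`, during `J`. -/
def Bearing.SolvesReduced (B : Bearing n) (c : Fin n → ℝ) (J : Set ℝ) (y : ℝ → Red n) : Prop :=
  ∀ t ∈ J,
    HasDerivAt (fun s => B.momentum (y s).1 (y s).2)
      (B.momentum (y t).1 (y t).2 ⨯₃ (y t).1
        + (1 - B.eps) • (B.gyro c (y t).2 ⨯₃ (y t).1)) t ∧
    ∀ i, HasDerivAt (fun s => (y s).2 i) (B.eps • ((y t).2 i ⨯₃ (y t).1)) t

/-- The vector space of the quadruples `(Ω, g, (gᵢ), (Γᵢ))`. -/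
abbrev Coord (n : ℕ) : Type := V3 × M3 × (Fin n → M3) × (Fin n → V3)

/-- The manifold `ℝ³ × SO(3)^{n+1} × (S²)ⁿ` of the quadruples `(Ω, g, (gᵢ), (Γᵢ))`. -/
def coordSpace (n : ℕ) : Set (Coord n) :=
  {z | z.2.1 ∈ SO3 ∧ (∀ i, z.2.2.1 i ∈ SO3) ∧ ∀ i, z.2.2.2 i ∈ S2}

/-- The coordinates `(Ω, g, (gᵢ), (Γᵢ))`, `Γᵢ = g⁻¹ γᵢ`, of a point of `TQ`. -/
def coords (x : Conf n × Conf n) : Coord n :=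
  (bodyAngVel x.1 x.2, x.1.1, x.1.2.1, fun i => x.1.1ᵀ *ᵥ x.1.2.2 i)

/-- The configuration `(g, (gᵢ), (γᵢ))`, `γᵢ = g Γᵢ`, with the given coordinates. -/
def confOf (z : Coord n) : Conf n :=
  (z.2.1, z.2.2.1, fun i => z.2.1 *ᵥ z.2.2.2 i)

/-- The complete system for the curve `z = (Ω, g, (gᵢ), (Γᵢ))`, during `J`: the closed system and
the reconstruction equations `ġ = g Ω`, `ġᵢ = (g Ωᵢ g⁻¹) gᵢ`. -/
def Bearing.SolvesComplete (B : Bearing n) (c : Fin n → ℝ) (J : Set ℝ) (z : ℝ → Coord n) : Prop :=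
  B.SolvesReduced c J (fun t => ((z t).1, (z t).2.2.2)) ∧
  ∀ t ∈ J,
    HasDerivAt (fun s => (z s).2.1) ((z t).2.1 * hat (z t).1) t ∧
    ∀ i, HasDerivAt (fun s => (z s).2.2.1 i)
      ((z t).2.1 * hat (B.ballOmega c (z t).1 (z t).2.2.2 i) * (z t).2.1ᵀ * (z t).2.2.1 i) t

/-! ### Symmetry and reduction -/

/-- The action of `(a, (bᵢ)) ∈ SO(3)^{n+1}`:
`(g, gᵢ, γᵢ) ↦ (a g, a gᵢ bᵢ⁻¹, a γᵢ)`. It is linear, so it has the same form on velocities. -/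
def act (a : M3) (b : Fin n → M3) (q : Conf n) : Conf n :=
  (a * q.1, fun i => a * q.2.1 i * (b i)ᵀ, fun i => a *ᵥ q.2.2 i)

/-- Two points of `TQ` are on the same orbit of `SO(3)^{n+1}`. -/
def SameOrbit (x y : Conf n × Conf n) : Prop :=
  ∃ a ∈ SO3, ∃ b : Fin n → M3, (∀ i, b i ∈ SO3) ∧ y = (act a b x.1, act a b x.2)

/-- The vector space of the quadruples `(Ω, (Ωᵢ), (Γ̇ᵢ), (Γᵢ))`. -/
abbrev Quot1 (n : ℕ) : Type := V3 × (Fin n → V3) × (Fin n → V3) × (Fin n → V3)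

/-- The manifold `ℝ^{3(n+1)} × (TS²)ⁿ` of the quadruples `(Ω, (Ωᵢ), (Γ̇ᵢ), (Γᵢ))`. -/
def quotSpace (n : ℕ) : Set (Quot1 n) :=
  {y | ∀ i, y.2.2.2 i ∈ S2 ∧ y.2.2.2 i ⬝ᵥ y.2.2.1 i = 0}

/-- The projection of `TQ` to `(TQ)/SO(3)^{n+1}`, the latter in the coordinates
`(Ω, (Ωᵢ), (Γ̇ᵢ), (Γᵢ))`: `Ωᵢ = g⁻¹ ωᵢ`, `Γᵢ = g⁻¹ γᵢ`, `Γ̇ᵢ` the time derivative of `Γᵢ`. -/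
def quotMap (x : Conf n × Conf n) : Quot1 n :=
  (bodyAngVel x.1 x.2,
    fun i => x.1.1ᵀ *ᵥ ballAngVel x.1 x.2 i,
    fun i => x.1.1ᵀ *ᵥ x.2.2.2 i + x.2.1ᵀ *ᵥ x.1.2.2 i,
    fun i => x.1.1ᵀ *ᵥ x.1.2.2 i)

/-- `ℳ_c = 𝒟_c / SO(3)^{n+1}`, in the coordinates `(Ω, (Ωᵢ), (Γ̇ᵢ), (Γᵢ))`. -/
def Bearing.redPhaseC (B : Bearing n) (c : Fin n → ℝ) : Set (Quot1 n) :=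
  quotMap '' B.phaseC c

/-- The projection `π` to `𝒩`: `(Ω, (Ωᵢ), (Γ̇ᵢ), (Γᵢ)) ↦ (Ω, (Γᵢ))`. -/
def proj (y : Quot1 n) : Red n := (y.1, y.2.2.2)

/-- `f` restricts to a diffeomorphism of the embedded sets `S ⊂ E` and `T ⊂ F`: it maps `S` to `T`,
and some map that is smooth near `T` maps `T` back to `S` and inverts it. -/
def IsDiffeo {E F : Type*} [NormedAddCommGroup E] [NormedSpace ℝ E] [NormedAddCommGroup F]
    [NormedSpace ℝ F] (f : E → F) (S : Set E) (T : Set F) : Prop :=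
  (∀ x ∈ S, f x ∈ T ∧ ContDiffAt ℝ ∞ f x) ∧
  ∃ h : F → E, (∀ y ∈ T, h y ∈ S ∧ ContDiffAt ℝ ∞ h y ∧ f (h y) = y) ∧ ∀ x ∈ S, h (f x) = x

end

end BallBearing

open BallBearing

/-!
# The spherical ball bearing: reduction of the rolling motion

The two rolling conditions of a ball are linear equations for `γᵢ'` and `ωᵢ × γᵢ`. Their sum and
their difference give `γᵢ' = (1 - ε) ω × γᵢ` and `ωᵢ × γᵢ = δ ω × γᵢ`, in all four configurations
with the same proof, because only `2 D (1 - ε) = D + b` and `2 b δ = D + b` are used, with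
`D = |OOᵢ|` and `OᵢBᵢ = b γᵢ`.
Hence a velocity in the distribution at a given configuration is the same as the angular velocity
`Ω` of the moving sphere together with the spins `cᵢ = ⟨ωᵢ, γᵢ⟩` (`Bearing.eq_rollingVel`), which
yields the coordinates on `𝒟_c` and the form of `ℳ_c`.

For a left-invariant frame on the rotation group of the sphere and right-invariant frames for the
balls, the Lagrange derivative of the kinetic energy is
`⟨𝕀 Ω' - 𝕀 Ω × Ω, η⟩ + ∑ Iᵢ ⟨ωᵢ', ξᵢ⟩ + ∑ mᵢ D² ⟨γᵢ'', wᵢ⟩` (`Bearing.eulerLagrange_energy`). On a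
virtual displacement that satisfies the constraints, with the parameters `η` and `sᵢ`, it becomes
`⟨M' - M × Ω - (1 - ε) N × Ω, η⟩ + ∑ Iᵢ cᵢ' sᵢ` (`Bearing.eulerLagrange_rollingVel`); the mass terms
combine with the inertia terms since `D (1 - ε) = b δ` and `b² = r²`. As `η` and `sᵢ` are arbitrary,
a curve in the phase space is a motion iff the spins are constant and the equation of `M` holds. The
equation of `Γᵢ` and the reconstruction equations are the constraints.

The modified inertia operator `𝐈`, with `M = 𝐈 Ω`, is positive definite, so that the equation of `M`
can be solved for `Ω'`: this is the smooth vector field `Bearing.reducedField` on `𝒩`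
(`Bearing.solvesReduced_iff`). It also shows that `Ω` is differentiable along a solution, although
only `M` is assumed to be.

A solution of the reduced system determines `Ω` and `Ωᵢ` as functions of time, and it is lifted to a
motion by solving linear equations `G' = G Â` in `SO(3)` on the whole open interval
(`exists_rotation`): the Picard-Lindelöf theorem gives solutions on compact intervals, and these fit
together since two solutions differ by a constant rotation.
-/

namespace BallBearing

/-! ### Differential calculus of matrix and vector products -/

section Calculus

variable {E F G H : Type*} [NormedAddCommGroup E] [NormedSpace ℝ E]
  [NormedAddCommGroup F] [NormedSpace ℝ F] [FiniteDimensional ℝ F]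
  [NormedAddCommGroup G] [NormedSpace ℝ G] [FiniteDimensional ℝ G]
  [NormedAddCommGroup H] [NormedSpace ℝ H]

theorem contDiffAt_bilin (b : F →ₗ[ℝ] G →ₗ[ℝ] H) {k : WithTop ℕ∞} {f : E → F} {g : E → G} {x : E}
    (hf : ContDiffAt ℝ k f x) (hg : ContDiffAt ℝ k g x) :
    ContDiffAt ℝ k (fun y => b (f y) (g y)) x := by
  have h := b.toContinuousBilinearMap.isBoundedBilinearMap.contDiff.contDiffAt
    (n := k) (x := (f x, g x))
  exact h.comp x (hf.prodMk hg)

theorem hasDerivAt_bilin (b : F →ₗ[ℝ] G →ₗ[ℝ] H) {f : ℝ → F} {g : ℝ → G} {f' : F} {g' : G} {t : ℝ}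
    (hf : HasDerivAt f f' t) (hg : HasDerivAt g g' t) :
    HasDerivAt (fun s => b (f s) (g s)) (b (f t) g' + b f' (g t)) t := by
  have h := b.toContinuousBilinearMap.isBoundedBilinearMap.hasFDerivAt (f t, g t)
  exact h.comp_hasDerivAt t (hf.prodMk hg)

theorem hasDerivAt_lin (l : F →ₗ[ℝ] H) {f : ℝ → F} {f' : F} {t : ℝ}
    (hf : HasDerivAt f f' t) : HasDerivAt (fun s => l (f s)) (l f') t :=
  (l.toContinuousLinearMap.hasFDerivAt (x := f t)).comp_hasDerivAt t hf

theorem contDiffAt_lin (l : F →ₗ[ℝ] H) {k : WithTop ℕ∞} {f : E → F} {x : E}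
    (hf : ContDiffAt ℝ k f x) : ContDiffAt ℝ k (fun y => l (f y)) x :=
  (l.toContinuousLinearMap.contDiff.contDiffAt (x := f x)).comp x hf

/-- `hat` as a linear map. -/
noncomputable def hatLin : V3 →ₗ[ℝ] M3 where
  toFun := hat
  map_add' a b := by ext i j; fin_cases i <;> fin_cases j <;> simp [hat] <;> ring
  map_smul' s a := by ext i j; fin_cases i <;> fin_cases j <;> simp [hat]

/-- `vee` as a linear map. -/
noncomputable def veeLin : M3 →ₗ[ℝ] V3 where
  toFun := vee
  map_add' a b := by ext i; fin_cases i <;> simp [vee] <;> ring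
  map_smul' s a := by ext i; fin_cases i <;> simp [vee] <;> ring

variable {k : WithTop ℕ∞} {x : E} {t : ℝ}

@[fun_prop]
theorem _root_.ContDiffAt.m3_mul {f g : E → M3} (hf : ContDiffAt ℝ k f x)
    (hg : ContDiffAt ℝ k g x) : ContDiffAt ℝ k (fun y => f y * g y) x :=
  contDiffAt_bilin (LinearMap.mul ℝ M3) hf hg

theorem _root_.HasDerivAt.m3_mul {f g : ℝ → M3} {f' g' : M3} (hf : HasDerivAt f f' t)
    (hg : HasDerivAt g g' t) : HasDerivAt (fun s => f s * g s) (f t * g' + f' * g t) t :=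
  hasDerivAt_bilin (LinearMap.mul ℝ M3) hf hg

@[fun_prop]
theorem _root_.ContDiffAt.m3_mulVec {f : E → M3} {g : E → V3} (hf : ContDiffAt ℝ k f x)
    (hg : ContDiffAt ℝ k g x) : ContDiffAt ℝ k (fun y => f y *ᵥ g y) x :=
  contDiffAt_bilin (Matrix.mulVecBilin ℝ ℝ) hf hg

theorem _root_.HasDerivAt.m3_mulVec {f : ℝ → M3} {g : ℝ → V3} {f' : M3} {g' : V3}
    (hf : HasDerivAt f f' t) (hg : HasDerivAt g g' t) :
    HasDerivAt (fun s => f s *ᵥ g s) (f t *ᵥ g' + f' *ᵥ g t) t :=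
  hasDerivAt_bilin (Matrix.mulVecBilin ℝ ℝ) hf hg

@[fun_prop]
theorem _root_.ContDiffAt.v3_cross {f g : E → V3} (hf : ContDiffAt ℝ k f x)
    (hg : ContDiffAt ℝ k g x) : ContDiffAt ℝ k (fun y => f y ⨯₃ g y) x :=
  contDiffAt_bilin crossProduct hf hg

theorem _root_.HasDerivAt.v3_cross {f g : ℝ → V3} {f' g' : V3}
    (hf : HasDerivAt f f' t) (hg : HasDerivAt g g' t) :
    HasDerivAt (fun s => f s ⨯₃ g s) (f t ⨯₃ g' + f' ⨯₃ g t) t :=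
  hasDerivAt_bilin crossProduct hf hg

@[fun_prop]
theorem _root_.ContDiffAt.v3_dot {f g : E → V3} (hf : ContDiffAt ℝ k f x)
    (hg : ContDiffAt ℝ k g x) : ContDiffAt ℝ k (fun y => f y ⬝ᵥ g y) x :=
  contDiffAt_bilin (dotProductBilin ℝ ℝ) hf hg

theorem _root_.HasDerivAt.v3_dot {f g : ℝ → V3} {f' g' : V3}
    (hf : HasDerivAt f f' t) (hg : HasDerivAt g g' t) :
    HasDerivAt (fun s => f s ⬝ᵥ g s) (f t ⬝ᵥ g' + f' ⬝ᵥ g t) t :=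
  hasDerivAt_bilin (dotProductBilin ℝ ℝ) hf hg

@[fun_prop]
theorem _root_.ContDiffAt.m3_transpose {f : E → M3} (hf : ContDiffAt ℝ k f x) :
    ContDiffAt ℝ k (fun y => (f y)ᵀ) x :=
  contDiffAt_lin (Matrix.transposeLinearEquiv (Fin 3) (Fin 3) ℝ ℝ).toLinearMap hf

theorem _root_.HasDerivAt.m3_transpose {f : ℝ → M3} {f' : M3} (hf : HasDerivAt f f' t) :
    HasDerivAt (fun s => (f s)ᵀ) f'ᵀ t :=
  hasDerivAt_lin (Matrix.transposeLinearEquiv (Fin 3) (Fin 3) ℝ ℝ).toLinearMap hf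

@[fun_prop]
theorem _root_.ContDiffAt.hat {f : E → V3} (hf : ContDiffAt ℝ k f x) :
    ContDiffAt ℝ k (fun y => hat (f y)) x := contDiffAt_lin hatLin hf

@[fun_prop]
theorem _root_.ContDiffAt.vee {f : E → M3} (hf : ContDiffAt ℝ k f x) :
    ContDiffAt ℝ k (fun y => vee (f y)) x := contDiffAt_lin veeLin hf

theorem _root_.HasDerivAt.vee {f : ℝ → M3} {f' : M3} (hf : HasDerivAt f f' t) :
    HasDerivAt (fun s => vee (f s)) (vee f') t := hasDerivAt_lin veeLin hf

end Calculus

variable {n : ℕ}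

/-! ### Rotations and vector products -/

theorem mem_SO3 {g : M3} : g ∈ SO3 ↔ g * gᵀ = 1 ∧ g.det = 1 := by
  change g ∈ Matrix.specialOrthogonalGroup (Fin 3) ℝ ↔ _
  rw [Matrix.mem_specialOrthogonalGroup_iff, Matrix.mem_orthogonalGroup_iff]

theorem SO3_mul_transpose {g : M3} (hg : g ∈ SO3) : g * gᵀ = 1 := (mem_SO3.1 hg).1

theorem SO3_transpose_mul {g : M3} (hg : g ∈ SO3) : gᵀ * g = 1 :=
  mul_eq_one_comm.1 (SO3_mul_transpose hg)

theorem SO3_transpose {g : M3} (hg : g ∈ SO3) : gᵀ ∈ SO3 :=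
  mem_SO3.2 ⟨by simpa using SO3_transpose_mul hg, by simpa using (mem_SO3.1 hg).2⟩

theorem SO3_mul {g h : M3} (hg : g ∈ SO3) (hh : h ∈ SO3) : g * h ∈ SO3 :=
  (Matrix.specialOrthogonalGroup (Fin 3) ℝ).mul_mem hg hh

theorem SO3_one : (1 : M3) ∈ SO3 := (Matrix.specialOrthogonalGroup (Fin 3) ℝ).one_mem

theorem SO3_transpose_mulVec {g : M3} (hg : g ∈ SO3) (a : V3) : gᵀ *ᵥ (g *ᵥ a) = a := by
  rw [Matrix.mulVec_mulVec, SO3_transpose_mul hg, Matrix.one_mulVec]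

theorem SO3_mulVec_transpose {g : M3} (hg : g ∈ SO3) (a : V3) : g *ᵥ (gᵀ *ᵥ a) = a := by
  rw [Matrix.mulVec_mulVec, SO3_mul_transpose hg, Matrix.one_mulVec]

theorem SO3_dot {g : M3} (hg : g ∈ SO3) (a b : V3) : (g *ᵥ a) ⬝ᵥ (g *ᵥ b) = a ⬝ᵥ b := by
  rw [Matrix.dotProduct_mulVec, Matrix.vecMul_mulVec, SO3_transpose_mul hg, Matrix.vecMul_one]

theorem SO3_dot_mulVec {g : M3} (hg : g ∈ SO3) (a b : V3) : a ⬝ᵥ (g *ᵥ b) = (gᵀ *ᵥ a) ⬝ᵥ b := by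
  rw [← SO3_dot (SO3_transpose hg) a, SO3_transpose_mulVec hg]

theorem SO3_mem_S2 {g : M3} (hg : g ∈ SO3) {a : V3} (ha : a ∈ S2) : g *ᵥ a ∈ S2 :=
  (SO3_dot hg a a).trans ha

/-- Every matrix acts on vector products by its cofactor matrix, and the cofactor matrix of a
rotation is the rotation itself. -/
theorem SO3_cross {g : M3} (hg : g ∈ SO3) (a b : V3) :
    g *ᵥ (a ⨯₃ b) = (g *ᵥ a) ⨯₃ (g *ᵥ b) := by
  have hadj : g.adjugateᵀ = g := by
    have h : g.adjugate = gᵀ := by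
      calc g.adjugate = (gᵀ * g) * g.adjugate := by rw [SO3_transpose_mul hg, one_mul]
        _ = gᵀ := by rw [mul_assoc, Matrix.mul_adjugate, (mem_SO3.1 hg).2, one_smul, mul_one]
    rw [h, Matrix.transpose_transpose]
  have h : g.adjugateᵀ *ᵥ (a ⨯₃ b) = (g *ᵥ a) ⨯₃ (g *ᵥ b) := by
    rw [Matrix.adjugate_fin_three]
    funext k
    fin_cases k <;>
      simp [crossProduct, Matrix.mulVec, dotProduct, Fin.sum_univ_three] <;> ring
  rwa [hadj] at h

theorem hat_transpose (a : V3) : (hat a)ᵀ = -hat a := by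
  ext i j; fin_cases i <;> fin_cases j <;> simp [hat]

theorem hat_neg (a : V3) : hat (-a) = -hat a := hatLin.map_neg a

theorem vee_neg (X : M3) : vee (-X) = -vee X := veeLin.map_neg X

theorem vee_add (X Y : M3) : vee (X + Y) = vee X + vee Y := veeLin.map_add X Y

theorem vee_smul (s : ℝ) (X : M3) : vee (s • X) = s • vee X := veeLin.map_smul s X

theorem hat_mulVec_SO3 {g : M3} (hg : g ∈ SO3) (a : V3) : hat (g *ᵥ a) = g * hat a * gᵀ := by
  refine Matrix.ext_of_mulVec_single fun i => ?_
  rw [hat_mulVec, ← Matrix.mulVec_mulVec, ← Matrix.mulVec_mulVec, hat_mulVec, SO3_cross hg,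
    SO3_mulVec_transpose hg]

/-- `[â, b̂]` is the matrix of `a × b`. -/
theorem vee_hat_mul_hat (a b : V3) : vee (hat a * hat b) = (1 / 2 : ℝ) • (a ⨯₃ b) := by
  funext k
  fin_cases k <;> simp [vee, hat, crossProduct, Matrix.mul_apply, Fin.sum_univ_three] <;> ring

theorem cross_cross_self {γ : V3} (hγ : γ ∈ S2) (x : V3) :
    γ ⨯₃ (x ⨯₃ γ) = x - (γ ⬝ᵥ x) • γ := by
  have h : γ ⬝ᵥ γ = 1 := hγ
  rw [cross_cross_eq_smul_sub_smul', h, one_smul, dotProduct_comm x]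

/-! ### Rolling velocities -/

theorem Bearing.contactA_eq (B : Bearing n) : B.contactA = -B.contactB := by
  unfold Bearing.contactA Bearing.contactB
  cases B.kind <;> simp

theorem Bearing.contactB_sq (B : Bearing n) : B.contactB ^ 2 = B.r ^ 2 := by
  unfold Bearing.contactB
  cases B.kind <;> simp

theorem Bearing.r_pos (B : Bearing n) : 0 < B.r := by
  have h := B.admissible
  revert h
  cases B.kind <;> simp only [Kind.Admissible] <;> intro h
  · exact h.2
  · exact h.1
  · linarith [h.2.1, h.2.2]
  · linarith [h.2.1, h.2.2]

theorem Bearing.contactB_ne (B : Bearing n) : B.contactB ≠ 0 := by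
  intro h
  have h2 := B.contactB_sq
  rw [h] at h2
  nlinarith [B.r_pos]

theorem Bearing.dist_ne (B : Bearing n) : B.dist ≠ 0 := by
  have h := B.admissible
  revert h
  unfold Bearing.dist
  cases B.kind <;> simp only [Kind.Admissible] <;> intro h
  · linarith [h.1, h.2]
  · intro h'; linarith [h.1, h.2]
  · intro h'; linarith [h.2.1, h.2.2]
  · intro h'; linarith [h.2.1, h.2.2]

/-- The angular velocity with which the centres of the balls go around `O` is `1 - ε` times that of
the moving sphere: the velocity of `Oᵢ` is half of the velocity of `Bᵢ`. -/
theorem Bearing.eps_eq (B : Bearing n) : 2 * B.dist * (1 - B.eps) = B.dist + B.contactB := by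
  have h0 := B.dist_ne
  revert h0
  unfold Bearing.dist Bearing.contactB Bearing.eps
  cases B.kind <;> simp only <;> intro h0
  · field_simp; ring
  · field_simp; ring
  · have : B.R - B.r ≠ 0 := fun h => h0 (by linarith)
    field_simp; ring
  · field_simp; ring

/-- The component of `ωᵢ` orthogonal to `γᵢ` is `δ` times that of `ω`: the points `Aᵢ` and `Bᵢ` of
the ball have the velocities `0` and `ω × OBᵢ`. -/
theorem Bearing.delta_eq (B : Bearing n) : 2 * B.contactB * B.delta = B.dist + B.contactB := by
  have hr := B.r_pos.ne'
  unfold Bearing.dist Bearing.contactB Bearing.delta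
  cases B.kind <;> simp only <;> field_simp <;> ring

/-- The translational inertia of a ball, `m D² (1 - ε)²` with `D = |OOᵢ|`, is `m r² δ²`. -/
theorem Bearing.dist_sq_mul (B : Bearing n) :
    B.dist ^ 2 * (1 - B.eps) ^ 2 = B.delta ^ 2 * B.r ^ 2 := by
  have h1 := B.eps_eq
  have h2 := B.delta_eq
  rw [← B.contactB_sq]
  linear_combination (1 / 4) * (2 * B.dist * (1 - B.eps) + (B.dist + B.contactB)) * h1 -
    (1 / 4) * (2 * B.contactB * B.delta + (B.dist + B.contactB)) * h2

/-- The constraints, solved for the velocities: the sum and the difference of the two rolling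
conditions. -/
theorem Bearing.mem_distribution_iff (B : Bearing n) {q v : Conf n} :
    v ∈ B.distribution q ↔ v ∈ tangentQ q ∧ ∀ i,
      v.2.2 i = (1 - B.eps) • (angVel q v ⨯₃ q.2.2 i) ∧
      ballAngVel q v i ⨯₃ q.2.2 i = B.delta • (angVel q v ⨯₃ q.2.2 i) := by
  have hb := B.contactB_ne
  have hd := B.dist_ne
  have he := B.eps_eq
  have hδ := B.delta_eq
  refine and_congr_right fun _ => forall_congr' fun i => ?_
  rw [B.contactA_eq, Bearing.centreVel]
  simp only [map_smul]
  generalize ballAngVel q v i ⨯₃ q.2.2 i = x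
  generalize angVel q v ⨯₃ q.2.2 i = y
  constructor
  · rintro ⟨h1, h2⟩
    constructor <;> funext k
    · have h1 := congrFun h1 k
      have h2 := congrFun h2 k
      simp at h1 h2 ⊢
      apply mul_left_cancel₀ (mul_ne_zero two_ne_zero hd)
      linear_combination h1 + h2 - y k * he
    · have h1 := congrFun h1 k
      have h2 := congrFun h2 k
      simp at h1 h2 ⊢
      apply mul_left_cancel₀ (mul_ne_zero two_ne_zero hb)
      linear_combination h2 - h1 - y k * hδ
  · rintro ⟨h1, rfl⟩
    rw [h1]
    constructor <;> funext k <;> simp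
    · linear_combination (y k / 2) * he - (y k / 2) * hδ
    · linear_combination (y k / 2) * he + (y k / 2) * hδ

theorem SO3_conj_skew {g v : M3} (hg : g ∈ SO3) (hv : (gᵀ * v)ᵀ = -(gᵀ * v)) :
    (v * gᵀ)ᵀ = -(v * gᵀ) := by
  have h : v * gᵀ = g * (gᵀ * v) * gᵀ := by
    rw [← mul_assoc, SO3_mul_transpose hg, one_mul]
  rw [h, Matrix.transpose_mul, Matrix.transpose_mul, hv]
  simp [mul_assoc]

theorem vel_eq_mul_hat {q v : Conf n} (hq : q ∈ Q n) (hv : v ∈ tangentQ q) :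
    v.1 = q.1 * hat (bodyAngVel q v) := by
  rw [bodyAngVel, hat_vee _ hv.1, ← mul_assoc, SO3_mul_transpose hq.1, one_mul]

theorem ballVel_eq_hat_mul {q v : Conf n} (hq : q ∈ Q n) (hv : v ∈ tangentQ q) (i : Fin n) :
    v.2.1 i = hat (ballAngVel q v i) * q.2.1 i := by
  rw [ballAngVel, hat_vee _ (SO3_conj_skew (hq.2.1 i) (hv.2.1 i)), mul_assoc,
    SO3_transpose_mul (hq.2.1 i), mul_one]

theorem angVel_eq {q v : Conf n} (hq : q ∈ Q n) (hv : v ∈ tangentQ q) :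
    angVel q v = q.1 *ᵥ bodyAngVel q v := by
  rw [angVel, vel_eq_mul_hat hq hv, ← hat_mulVec_SO3 hq.1, vee_hat]

/-- The direction `Γᵢ = g⁻¹ γᵢ` from `O` to the centre of a ball, in the moving frame. -/
noncomputable def bodyDir (q : Conf n) (i : Fin n) : V3 := q.1ᵀ *ᵥ q.2.2 i

theorem bodyDir_mem {q : Conf n} (hq : q ∈ Q n) (i : Fin n) : bodyDir q i ∈ S2 :=
  SO3_mem_S2 (SO3_transpose hq.1) (hq.2.2 i)

theorem mulVec_bodyDir {q : Conf n} (hq : q ∈ Q n) (i : Fin n) :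
    q.1 *ᵥ bodyDir q i = q.2.2 i := SO3_mulVec_transpose hq.1 _

/-- The velocity at `q` that satisfies the constraints, for which the moving sphere has the angular
velocity `η` in its own frame and the balls have the spins `⟨ωᵢ, γᵢ⟩ = s i`. -/
noncomputable def Bearing.rollingVel (B : Bearing n) (s : Fin n → ℝ) (η : V3) (q : Conf n) :
    Conf n :=
  (q.1 * hat η,
    fun i => q.1 * hat (B.ballOmega s η (bodyDir q) i) * q.1ᵀ * q.2.1 i,
    fun i => (1 - B.eps) • (q.1 *ᵥ (η ⨯₃ bodyDir q i)))

theorem Bearing.bodyAngVel_rollingVel (B : Bearing n) (s : Fin n → ℝ) (η : V3) {q : Conf n}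
    (hq : q ∈ Q n) : bodyAngVel q (B.rollingVel s η q) = η := by
  rw [bodyAngVel, rollingVel, ← mul_assoc, SO3_transpose_mul hq.1, one_mul, vee_hat]

theorem Bearing.ballAngVel_rollingVel (B : Bearing n) (s : Fin n → ℝ) (η : V3) {q : Conf n}
    (hq : q ∈ Q n) (i : Fin n) :
    ballAngVel q (B.rollingVel s η q) i = q.1 *ᵥ B.ballOmega s η (bodyDir q) i := by
  rw [ballAngVel, rollingVel]
  simp only
  rw [mul_assoc _ (q.2.1 i), SO3_mul_transpose (hq.2.1 i), mul_one, ← hat_mulVec_SO3 hq.1, vee_hat]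

theorem Bearing.rollingVel_mem_tangentQ (B : Bearing n) (s : Fin n → ℝ) (η : V3) {q : Conf n}
    (hq : q ∈ Q n) : B.rollingVel s η q ∈ tangentQ q := by
  refine ⟨?_, fun i => ?_, fun i => ?_⟩
  · rw [rollingVel, ← mul_assoc, SO3_transpose_mul hq.1, one_mul, hat_transpose]
  · simp only [rollingVel]
    rw [← hat_mulVec_SO3 hq.1]
    simp [Matrix.transpose_mul, hat_transpose, mul_assoc]
  · simp only [rollingVel]
    rw [SO3_cross hq.1, mulVec_bodyDir hq, dotProduct_smul, dot_cross_self, smul_zero]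

theorem Bearing.dot_ballOmega (B : Bearing n) (s : Fin n → ℝ) (η : V3) {Γ : Fin n → V3} {i : Fin n}
    (hΓ : Γ i ∈ S2) : B.ballOmega s η Γ i ⬝ᵥ Γ i = s i := by
  have h : Γ i ⬝ᵥ Γ i = 1 := hΓ
  simp only [ballOmega, add_dotProduct, sub_dotProduct, smul_dotProduct, h, smul_eq_mul,
    dotProduct_comm η]
  ring

theorem Bearing.ballOmega_cross (B : Bearing n) (s : Fin n → ℝ) (η : V3) (Γ : Fin n → V3)
    (i : Fin n) : B.ballOmega s η Γ i ⨯₃ Γ i = B.delta • (η ⨯₃ Γ i) := by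
  simp [ballOmega]

theorem Bearing.ballSpin_rollingVel (B : Bearing n) (s : Fin n → ℝ) (η : V3) {q : Conf n}
    (hq : q ∈ Q n) (i : Fin n) : ballAngVel q (B.rollingVel s η q) i ⬝ᵥ q.2.2 i = s i := by
  rw [B.ballAngVel_rollingVel s η hq, ← mulVec_bodyDir hq i, SO3_dot hq.1,
    B.dot_ballOmega s η (bodyDir_mem hq i)]

theorem Bearing.rollingVel_mem_distribution (B : Bearing n) (s : Fin n → ℝ) (η : V3) {q : Conf n}
    (hq : q ∈ Q n) : B.rollingVel s η q ∈ B.distribution q := by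
  have ht := B.rollingVel_mem_tangentQ s η hq
  refine B.mem_distribution_iff.2 ⟨ht, fun i => ?_⟩
  rw [angVel_eq hq ht, B.bodyAngVel_rollingVel s η hq, B.ballAngVel_rollingVel s η hq,
    ← mulVec_bodyDir hq i, ← SO3_cross hq.1, ← SO3_cross hq.1, B.ballOmega_cross,
    Matrix.mulVec_smul]
  exact ⟨rfl, rfl⟩

/-- Every velocity that satisfies the constraints is determined by the angular velocity of the
moving sphere and the spins of the balls. -/
theorem Bearing.eq_rollingVel (B : Bearing n) {q v : Conf n} (hq : q ∈ Q n)
    (hv : v ∈ B.distribution q) :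
    v = B.rollingVel (fun i => ballAngVel q v i ⬝ᵥ q.2.2 i) (bodyAngVel q v) q := by
  obtain ⟨ht, h⟩ := B.mem_distribution_iff.1 hv
  refine Prod.ext ?_ (Prod.ext (funext fun i => ?_) (funext fun i => ?_))
  · exact vel_eq_mul_hat hq ht
  · simp only [rollingVel]
    rw [← hat_mulVec_SO3 hq.1, ballVel_eq_hat_mul hq ht]
    congr 2
    have h2 := cross_cross_self (hq.2.2 i) (ballAngVel q v i)
    rw [(h i).2, map_smul, cross_cross_self (hq.2.2 i), angVel_eq hq ht] at h2
    rw [eq_sub_iff_add_eq] at h2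
    rw [← h2, ballOmega]
    simp only [Matrix.mulVec_add, Matrix.mulVec_sub, Matrix.mulVec_smul, mulVec_bodyDir hq]
    rw [SO3_dot_mulVec hq.1, bodyDir, dotProduct_comm (q.2.2 i) (ballAngVel q v i)]
    module
  · simp only [rollingVel]
    rw [SO3_cross hq.1, mulVec_bodyDir hq, ← angVel_eq hq ht]
    exact (h i).1

/-! ### The Lagrange derivative of the energy -/

theorem bodyAngVel_add_smul (q v w : Conf n) (s : ℝ) :
    bodyAngVel q (v + s • w) = bodyAngVel q v + s • bodyAngVel q w := by
  simp [bodyAngVel, mul_add, vee_add, vee_smul]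

theorem bodyAngVel_add_smul_left (q p v : Conf n) (s : ℝ) :
    bodyAngVel (q + s • p) v = bodyAngVel q v + s • bodyAngVel p v := by
  simp [bodyAngVel, add_mul, vee_add, vee_smul]

theorem ballAngVel_add_smul (q v w : Conf n) (s : ℝ) (i : Fin n) :
    ballAngVel q (v + s • w) i = ballAngVel q v i + s • ballAngVel q w i := by
  simp [ballAngVel, add_mul, vee_add, vee_smul]

theorem ballAngVel_add_smul_left (q p v : Conf n) (s : ℝ) (i : Fin n) :
    ballAngVel (q + s • p) v i = ballAngVel q v i + s • ballAngVel p v i := by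
  simp [ballAngVel, mul_add, vee_add, vee_smul]

theorem hasDerivAt_add_smul (a b : V3) : HasDerivAt (fun s : ℝ => a + s • b) b 0 := by
  simpa using ((hasDerivAt_id (0 : ℝ)).smul_const b).const_add a

theorem Bearing.hasDerivAt_energy (B : Bearing n) {q v : ℝ → Conf n} {a : V3}
    {b d : Fin n → V3} {t : ℝ}
    (ha : HasDerivAt (fun s => bodyAngVel (q s) (v s)) a t)
    (hb : ∀ i, HasDerivAt (fun s => ballAngVel (q s) (v s) i) (b i) t)
    (hd : ∀ i, HasDerivAt (fun s => (v s).2.2 i) (d i) t) :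
    HasDerivAt (fun s => B.energy (q s) (v s))
      (∑ k, B.inertia k * (bodyAngVel (q t) (v t) k * a k)
        + ∑ i, B.ballInertia i * (ballAngVel (q t) (v t) i ⬝ᵥ b i)
        + ∑ i, B.mass i * (B.dist ^ 2 * ((v t).2.2 i ⬝ᵥ d i))) t := by
  unfold energy centreVel
  have h1 : HasDerivAt (fun s => ∑ k, B.inertia k * bodyAngVel (q s) (v s) k ^ 2) _ t :=
    HasDerivAt.fun_sum fun k _ => (((hasDerivAt_pi.1 ha) k).pow 2).const_mul (B.inertia k)
  have h2 : HasDerivAt (fun s => ∑ i, B.ballInertia i *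
      (ballAngVel (q s) (v s) i ⬝ᵥ ballAngVel (q s) (v s) i)) _ t :=
    HasDerivAt.fun_sum fun i _ => ((hb i).v3_dot (hb i)).const_mul (B.ballInertia i)
  have h3 : HasDerivAt (fun s => ∑ i, B.mass i *
      ((B.dist • (v s).2.2 i) ⬝ᵥ (B.dist • (v s).2.2 i))) _ t :=
    HasDerivAt.fun_sum fun i _ =>
      (((hd i).const_smul B.dist).v3_dot ((hd i).const_smul B.dist)).const_mul (B.mass i)
  convert! ((h1.const_mul (1 / 2)).add (h2.const_mul (1 / 2))).add (h3.const_mul (1 / 2)) using 1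
  simp only [Finset.mul_sum]
  congr 1
  · congr 1
    · exact Finset.sum_congr rfl fun k _ => by simp; ring
    · exact Finset.sum_congr rfl fun i _ => by rw [dotProduct_comm (b i)]; ring
  · refine Finset.sum_congr rfl fun i _ => ?_
    rw [dotProduct_comm (B.dist • d i)]
    simp only [Pi.smul_apply, smul_dotProduct, dotProduct_smul, smul_eq_mul]
    ring

theorem Bearing.lineDeriv_energy_vel (B : Bearing n) (q v w : Conf n) :
    lineDeriv ℝ (fun u => B.energy q u) v w =
      ∑ k, B.inertia k * (bodyAngVel q v k * bodyAngVel q w k)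
        + ∑ i, B.ballInertia i * (ballAngVel q v i ⬝ᵥ ballAngVel q w i)
        + ∑ i, B.mass i * (B.dist ^ 2 * (v.2.2 i ⬝ᵥ w.2.2 i)) := by
  have h := B.hasDerivAt_energy (q := fun _ => q) (v := fun s : ℝ => v + s • w) (t := 0)
    (a := bodyAngVel q w) (b := ballAngVel q w) (d := w.2.2)
    (by simpa only [bodyAngVel_add_smul] using hasDerivAt_add_smul _ _)
    (fun i => by simpa only [ballAngVel_add_smul] using hasDerivAt_add_smul _ _)
    (fun i => hasDerivAt_add_smul (v.2.2 i) (w.2.2 i))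
  simpa [lineDeriv] using h.deriv

theorem Bearing.lineDeriv_energy_pos (B : Bearing n) (q v w : Conf n) :
    lineDeriv ℝ (fun p => B.energy p v) q w =
      ∑ k, B.inertia k * (bodyAngVel q v k * bodyAngVel w v k)
        + ∑ i, B.ballInertia i * (ballAngVel q v i ⬝ᵥ ballAngVel w v i) := by
  have h := B.hasDerivAt_energy (q := fun s : ℝ => q + s • w) (v := fun _ => v) (t := 0)
    (a := bodyAngVel w v) (b := ballAngVel w v) (d := fun _ => 0)
    (by simpa only [bodyAngVel_add_smul_left] using hasDerivAt_add_smul _ _)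
    (fun i => by simpa only [ballAngVel_add_smul_left] using hasDerivAt_add_smul _ _)
    (fun i => hasDerivAt_const _ _)
  simpa [lineDeriv] using h.deriv

theorem _root_.HasDerivAt.fst_comp {E F : Type*} [NormedAddCommGroup E] [NormedSpace ℝ E]
    [NormedAddCommGroup F] [NormedSpace ℝ F] {f : ℝ → E × F} {f' : E × F} {t : ℝ}
    (h : HasDerivAt f f' t) : HasDerivAt (fun s => (f s).1) f'.1 t :=
  (hasFDerivAt_fst (𝕜 := ℝ) (p := f t)).comp_hasDerivAt t h

theorem _root_.HasDerivAt.snd_comp {E F : Type*} [NormedAddCommGroup E] [NormedSpace ℝ E]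
    [NormedAddCommGroup F] [NormedSpace ℝ F] {f : ℝ → E × F} {f' : E × F} {t : ℝ}
    (h : HasDerivAt f f' t) : HasDerivAt (fun s => (f s).2) f'.2 t :=
  (hasFDerivAt_snd (𝕜 := ℝ) (p := f t)).comp_hasDerivAt t h

theorem hasDerivAt_bodyAngVel {q v : ℝ → Conf n} {q' v' : Conf n} {t : ℝ}
    (hq : HasDerivAt q q' t) (hv : HasDerivAt v v' t) :
    HasDerivAt (fun s => bodyAngVel (q s) (v s)) (bodyAngVel (q t) v' + bodyAngVel q' (v t)) t := by
  rw [bodyAngVel, bodyAngVel, ← vee_add]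
  exact (hq.fst_comp.m3_transpose.m3_mul hv.fst_comp).vee

theorem hasDerivAt_ballAngVel {q v : ℝ → Conf n} {q' v' : Conf n} {t : ℝ}
    (hq : HasDerivAt q q' t) (hv : HasDerivAt v v' t) (i : Fin n) :
    HasDerivAt (fun s => ballAngVel (q s) (v s) i)
      (ballAngVel q' (v t) i + ballAngVel (q t) v' i) t := by
  rw [ballAngVel, ballAngVel, ← vee_add]
  exact ((hasDerivAt_pi.1 hv.snd_comp.fst_comp i).m3_mul
    (hasDerivAt_pi.1 hq.snd_comp.fst_comp i).m3_transpose).vee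

/-- Left-invariant vector fields on `SO(3)`: the commutator is the vector product. -/
theorem bodyAngVel_sub_swap {q v w : Conf n} (hq : q ∈ Q n) (hv : v ∈ tangentQ q)
    (hw : w ∈ tangentQ q) :
    bodyAngVel v w - bodyAngVel w v = bodyAngVel q w ⨯₃ bodyAngVel q v := by
  have h (a b : V3) : vee ((q.1 * hat a)ᵀ * (q.1 * hat b)) = -((1 / 2 : ℝ) • (a ⨯₃ b)) := by
    rw [Matrix.transpose_mul, hat_transpose, mul_assoc, ← mul_assoc q.1ᵀ, SO3_transpose_mul hq.1,
      one_mul, neg_mul, vee_neg, vee_hat_mul_hat]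
  have h1 : bodyAngVel v w = -((1 / 2 : ℝ) • (bodyAngVel q v ⨯₃ bodyAngVel q w)) := by
    rw [← h, ← vel_eq_mul_hat hq hv, ← vel_eq_mul_hat hq hw, bodyAngVel]
  have h2 : bodyAngVel w v = -((1 / 2 : ℝ) • (bodyAngVel q w ⨯₃ bodyAngVel q v)) := by
    rw [← h, ← vel_eq_mul_hat hq hv, ← vel_eq_mul_hat hq hw, bodyAngVel]
  rw [h1, h2, ← cross_anticomm (bodyAngVel q w) (bodyAngVel q v)]
  module

/-- Right-invariant vector fields on `SO(3)`: the commutator is minus the vector product. -/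
theorem ballAngVel_sub_swap {q v w : Conf n} (hq : q ∈ Q n) (hv : v ∈ tangentQ q)
    (hw : w ∈ tangentQ q) (i : Fin n) :
    ballAngVel v w i - ballAngVel w v i = ballAngVel q v i ⨯₃ ballAngVel q w i := by
  have h (a b : V3) : vee ((hat a * q.2.1 i) * (hat b * q.2.1 i)ᵀ) =
      -((1 / 2 : ℝ) • (a ⨯₃ b)) := by
    rw [Matrix.transpose_mul, hat_transpose, mul_assoc, ← mul_assoc (q.2.1 i),
      SO3_mul_transpose (hq.2.1 i), one_mul, mul_neg, vee_neg, vee_hat_mul_hat]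
  have h1 : ballAngVel v w i = -((1 / 2 : ℝ) • (ballAngVel q w i ⨯₃ ballAngVel q v i)) := by
    rw [← h, ← ballVel_eq_hat_mul hq hv, ← ballVel_eq_hat_mul hq hw, ballAngVel]
  have h2 : ballAngVel w v i = -((1 / 2 : ℝ) • (ballAngVel q v i ⨯₃ ballAngVel q w i)) := by
    rw [← h, ← ballVel_eq_hat_mul hq hv, ← ballVel_eq_hat_mul hq hw, ballAngVel]
  rw [h1, h2, ← cross_anticomm (ballAngVel q v i) (ballAngVel q w i)]
  module

/-- `⟨d/dt ∂T/∂q̇ - ∂T/∂q, w⟩` for a tangent vector `w` with the angular velocities `η` of the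
moving sphere (in its frame) and `ξᵢ` of the balls is `⟨𝕀 Ω' - 𝕀 Ω × Ω, η⟩ + ∑ Iᵢ ⟨ωᵢ', ξᵢ⟩ +
∑ mᵢ ⟨D² γᵢ'', wᵢ⟩`. -/
theorem Bearing.eulerLagrange_energy (B : Bearing n) {q : ℝ → Conf n} {t : ℝ} {a : V3}
    {b d : Fin n → V3} {w : Conf n} (hQ : q t ∈ Q n) (hv : deriv q t ∈ tangentQ (q t))
    (hw : w ∈ tangentQ (q t)) (hq : DifferentiableAt ℝ q t)
    (ha : HasDerivAt (fun s => bodyAngVel (q s) (deriv q s)) a t)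
    (hb : ∀ i, HasDerivAt (fun s => ballAngVel (q s) (deriv q s) i) (b i) t)
    (hd : ∀ i, HasDerivAt (fun s => (deriv q s).2.2 i) (d i) t) :
    eulerLagrange B.energy q t w =
      ((fun k => B.inertia k * a k) -
          (fun k => B.inertia k * bodyAngVel (q t) (deriv q t) k) ⨯₃ bodyAngVel (q t) (deriv q t))
          ⬝ᵥ bodyAngVel (q t) w
        + ∑ i, B.ballInertia i * (b i ⬝ᵥ ballAngVel (q t) w i)
        + ∑ i, B.mass i * (B.dist ^ 2 * (d i ⬝ᵥ w.2.2 i)) := by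
  -- The definition for a general `E`, restated with the instances that are found for `Conf n`.
  have hE : eulerLagrange B.energy q t w =
      deriv (fun s => lineDeriv ℝ (fun v => B.energy (q s) v) (deriv q s) w) t
        - lineDeriv ℝ (fun p => B.energy p (deriv q t)) (q t) w := rfl
  rw [hE]
  simp only [B.lineDeriv_energy_vel, B.lineDeriv_energy_pos]
  have hz : ballAngVel (q t) 0 = 0 := by funext i; simp [ballAngVel]; exact veeLin.map_zero
  have hz' : bodyAngVel (q t) 0 = 0 := by simp [bodyAngVel]; exact veeLin.map_zero
  have ha' := hasDerivAt_bodyAngVel hq.hasDerivAt (hasDerivAt_const t w)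
  have hb' := hasDerivAt_ballAngVel hq.hasDerivAt (hasDerivAt_const t w)
  simp only [hz, hz', Pi.zero_apply, zero_add, add_zero] at ha' hb'
  have h1 : HasDerivAt (fun s => ∑ k, B.inertia k *
      (bodyAngVel (q s) (deriv q s) k * bodyAngVel (q s) w k)) _ t :=
    HasDerivAt.fun_sum fun k _ =>
      ((hasDerivAt_pi.1 ha k).mul (hasDerivAt_pi.1 ha' k)).const_mul (B.inertia k)
  have h2 : HasDerivAt (fun s => ∑ i, B.ballInertia i *
      (ballAngVel (q s) (deriv q s) i ⬝ᵥ ballAngVel (q s) w i)) _ t :=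
    HasDerivAt.fun_sum fun i _ => ((hb i).v3_dot (hb' i)).const_mul (B.ballInertia i)
  have h3 : HasDerivAt (fun s => ∑ i, B.mass i *
      (B.dist ^ 2 * ((deriv q s).2.2 i ⬝ᵥ w.2.2 i))) _ t :=
    HasDerivAt.fun_sum fun i _ => (((hd i).v3_dot
      (hasDerivAt_const t (w.2.2 i))).const_mul (B.dist ^ 2)).const_mul (B.mass i)
  simp only [dotProduct_zero, zero_add] at h3
  have hsum : HasDerivAt (fun s => ∑ k, B.inertia k * (bodyAngVel (q s) (deriv q s) k *
        bodyAngVel (q s) w k) + ∑ i, B.ballInertia i * (ballAngVel (q s) (deriv q s) i ⬝ᵥ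
        ballAngVel (q s) w i) + ∑ i, B.mass i * (B.dist ^ 2 * ((deriv q s).2.2 i ⬝ᵥ w.2.2 i)))
      (∑ k, B.inertia k * (a k * bodyAngVel (q t) w k + bodyAngVel (q t) (deriv q t) k *
        bodyAngVel (deriv q t) w k) + ∑ i, B.ballInertia i * (ballAngVel (q t) (deriv q t) i ⬝ᵥ
        ballAngVel (deriv q t) w i + b i ⬝ᵥ ballAngVel (q t) w i) +
        ∑ i, B.mass i * (B.dist ^ 2 * (d i ⬝ᵥ w.2.2 i))) t := (h1.fun_add h2).fun_add h3
  rw [hsum.deriv]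
  have e1 : ∑ k, B.inertia k * (a k * bodyAngVel (q t) w k + bodyAngVel (q t) (deriv q t) k *
        bodyAngVel (deriv q t) w k) - ∑ k, B.inertia k * (bodyAngVel (q t) (deriv q t) k *
        bodyAngVel w (deriv q t) k) =
      ((fun k => B.inertia k * a k) -
          (fun k => B.inertia k * bodyAngVel (q t) (deriv q t) k) ⨯₃ bodyAngVel (q t) (deriv q t))
          ⬝ᵥ bodyAngVel (q t) w := by
    have h := bodyAngVel_sub_swap hQ hv hw
    generalize bodyAngVel (deriv q t) w = x at *
    rw [sub_eq_iff_eq_add] at h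
    subst h
    simp [Fin.sum_univ_three, crossProduct, dotProduct]
    ring
  have e2 : ∑ i, B.ballInertia i * (ballAngVel (q t) (deriv q t) i ⬝ᵥ ballAngVel (deriv q t) w i +
        b i ⬝ᵥ ballAngVel (q t) w i) - ∑ i, B.ballInertia i * (ballAngVel (q t) (deriv q t) i ⬝ᵥ
        ballAngVel w (deriv q t) i) = ∑ i, B.ballInertia i * (b i ⬝ᵥ ballAngVel (q t) w i) := by
    rw [← Finset.sum_sub_distrib]
    refine Finset.sum_congr rfl fun i _ => ?_
    have h := congrArg (ballAngVel (q t) (deriv q t) i ⬝ᵥ ·) (ballAngVel_sub_swap hQ hv hw i)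
    simp only [dot_self_cross, dotProduct_sub] at h
    linear_combination B.ballInertia i * h
  linear_combination e1 + e2

/-! ### The Lagrange derivative on the constraint distribution -/

/-- The time derivative of `M` for the velocities `a` of `Ω` and `Γ'` of `Γ`. -/
noncomputable def Bearing.momentumRate (B : Bearing n) (Ω : V3) (Γ : Fin n → V3) (a : V3)
    (Γ' : Fin n → V3) : V3 :=
  (fun k => B.inertia k * a k) + B.delta ^ 2 • ∑ i, (B.ballInertia i + B.mass i * B.r ^ 2) •
    (a - ((Γ i ⬝ᵥ Ω) • Γ' i + (Γ i ⬝ᵥ a + Γ' i ⬝ᵥ Ω) • Γ i))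

theorem Bearing.hasDerivAt_momentum (B : Bearing n) {Ω : ℝ → V3} {Γ : ℝ → Fin n → V3} {a : V3}
    {Γ' : Fin n → V3} {t : ℝ} (hΩ : HasDerivAt Ω a t)
    (hΓ : ∀ i, HasDerivAt (fun s => Γ s i) (Γ' i) t) :
    HasDerivAt (fun s => B.momentum (Ω s) (Γ s)) (B.momentumRate (Ω t) (Γ t) a Γ') t := by
  have h1 : HasDerivAt (fun s => (fun k => B.inertia k * Ω s k : V3))
      (fun k => B.inertia k * a k) t :=
    hasDerivAt_pi.2 fun k => (hasDerivAt_pi.1 hΩ k).const_mul _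
  have h2 : HasDerivAt (fun s => ∑ i, (B.ballInertia i + B.mass i * B.r ^ 2) •
      (Ω s - (Γ s i ⬝ᵥ Ω s) • Γ s i)) _ t :=
    HasDerivAt.fun_sum fun i _ =>
      (hΩ.fun_sub (((hΓ i).v3_dot hΩ).fun_smul (hΓ i))).fun_const_smul
        (B.ballInertia i + B.mass i * B.r ^ 2)
  exact h1.fun_add (h2.fun_const_smul (B.delta ^ 2))

/-- The velocity in the fixed frame of a vector that is known in a rotating frame. -/
theorem hasDerivAt_frame_mulVec {g : ℝ → M3} {X : ℝ → V3} {Ω X' : V3} {t : ℝ}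
    (hg : HasDerivAt g (g t * hat Ω) t) (hX : HasDerivAt X X' t) :
    HasDerivAt (fun s => g s *ᵥ X s) (g t *ᵥ (X' + Ω ⨯₃ X t)) t := by
  rw [Matrix.mulVec_add, ← hat_mulVec, Matrix.mulVec_mulVec]
  exact hg.m3_mulVec hX

section

variable {Γ Γ' Ω a η : V3} {e c c' δ s : ℝ}

/-- The contribution of the centre of a ball: `Γ × D(Ω × Γ) = D(Ω - ⟨Γ, Ω⟩ Γ)`, where
`D X = X' + Ω × X` is the time derivative in the fixed frame. -/
theorem centre_accel_dot (hΓ : Γ ∈ S2) (hΓ' : Γ' = e • (Γ ⨯₃ Ω)) :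
    ((a ⨯₃ Γ + Ω ⨯₃ Γ') + Ω ⨯₃ (Ω ⨯₃ Γ)) ⬝ᵥ (η ⨯₃ Γ) =
      (a - ((Γ ⬝ᵥ Ω) • Γ' + (Γ ⬝ᵥ a + Γ' ⬝ᵥ Ω) • Γ) + Ω ⨯₃ (Ω - (Γ ⬝ᵥ Ω) • Γ)) ⬝ᵥ η := by
  have h : Γ ⬝ᵥ Γ = 1 := hΓ
  subst hΓ'
  simp [crossProduct, dotProduct, Fin.sum_univ_three, Matrix.vecHead, Matrix.vecTail] at h ⊢
  linear_combination (a 0 * η 0 + a 1 * η 1 + a 2 * η 2) * h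

/-- The contribution of the rotation of a ball, `⟨D ωᵢ, ξᵢ⟩` for `ωᵢ = c Γ + δ (Ω - ⟨Γ, Ω⟩ Γ)` and
`ξᵢ = s Γ + δ (η - ⟨Γ, η⟩ Γ)`; the component of `D ωᵢ` along `Γ` is `c'`. -/
theorem ball_accel_dot (hΓ : Γ ∈ S2) (hΓ' : Γ' = e • (Γ ⨯₃ Ω)) :
    ((c • Γ' + c' • Γ + δ • a - ((δ * (Γ ⬝ᵥ Ω)) • Γ' + (δ * (Γ ⬝ᵥ a + Γ' ⬝ᵥ Ω)) • Γ))
        + Ω ⨯₃ (c • Γ + δ • Ω - (δ * (Γ ⬝ᵥ Ω)) • Γ)) ⬝ᵥ (s • Γ + δ • η - (δ * (Γ ⬝ᵥ η)) • Γ) =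
      c' * s + δ ^ 2 * ((a - ((Γ ⬝ᵥ Ω) • Γ' + (Γ ⬝ᵥ a + Γ' ⬝ᵥ Ω) • Γ)
        + Ω ⨯₃ (Ω - (Γ ⬝ᵥ Ω) • Γ)) ⬝ᵥ η) - (1 - e) * (δ * c * ((Γ ⨯₃ Ω) ⬝ᵥ η)) := by
  have h : Γ ⬝ᵥ Γ = 1 := hΓ
  have h1 : ((c • Γ' + c' • Γ + δ • a - ((δ * (Γ ⬝ᵥ Ω)) • Γ' + (δ * (Γ ⬝ᵥ a + Γ' ⬝ᵥ Ω)) • Γ))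
        + Ω ⨯₃ (c • Γ + δ • Ω - (δ * (Γ ⬝ᵥ Ω)) • Γ)) ⬝ᵥ Γ = c' := by
    subst hΓ'
    simp [crossProduct, dotProduct, Fin.sum_univ_three, Matrix.vecHead, Matrix.vecTail] at h ⊢
    linear_combination (c' - δ * (Γ 0 * a 0 + Γ 1 * a 1 + Γ 2 * a 2)) * h
  rw [dotProduct_sub, dotProduct_add, dotProduct_smul, dotProduct_smul, dotProduct_smul, h1]
  subst hΓ'
  simp [crossProduct, dotProduct, Fin.sum_univ_three, Matrix.vecHead, Matrix.vecTail]
  ring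

end

/-- The Lagrange derivative in the moving frame, summed over the balls. -/
theorem Bearing.sum_ball_contributions (B : Bearing n) (c c' s : Fin n → ℝ) (Ω a η : V3)
    (Γ Γ' : Fin n → V3) (hΓ : ∀ i, Γ i ∈ S2) (hΓ' : ∀ i, Γ' i = B.eps • (Γ i ⨯₃ Ω)) :
    ((fun k => B.inertia k * a k) - (fun k => B.inertia k * Ω k) ⨯₃ Ω) ⬝ᵥ η
      + ∑ i, B.ballInertia i * (((c i • Γ' i + c' i • Γ i + B.delta • a
          - ((B.delta * (Γ i ⬝ᵥ Ω)) • Γ' i + (B.delta * (Γ i ⬝ᵥ a + Γ' i ⬝ᵥ Ω)) • Γ i))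
          + Ω ⨯₃ B.ballOmega c Ω Γ i) ⬝ᵥ B.ballOmega s η Γ i)
      + ∑ i, B.mass i * (B.dist ^ 2 * ((1 - B.eps) ^ 2 *
          (((a ⨯₃ Γ i + Ω ⨯₃ Γ' i) + Ω ⨯₃ (Ω ⨯₃ Γ i)) ⬝ᵥ (η ⨯₃ Γ i)))) =
    (B.momentumRate Ω Γ a Γ'
        - (B.momentum Ω Γ ⨯₃ Ω + (1 - B.eps) • (B.gyro c Γ ⨯₃ Ω))) ⬝ᵥ η
      + ∑ i, B.ballInertia i * (c' i * s i) := by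
  simp only [ballOmega, fun i => ball_accel_dot (c := c i) (c' := c' i) (δ := B.delta) (s := s i)
    (a := a) (η := η) (hΓ i) (hΓ' i), fun i => centre_accel_dot (a := a) (η := η) (hΓ i) (hΓ' i)]
  simp only [momentumRate, momentum, gyro, map_add, map_smul, map_sum, LinearMap.add_apply,
    LinearMap.smul_apply, LinearMap.sum_apply, add_dotProduct]
  rw [sub_dotProduct, sub_dotProduct]
  simp only [add_dotProduct, smul_dotProduct, sum_dotProduct, smul_eq_mul]
  have key (x z z' g : Fin n → ℝ) (hz : ∀ i, z' i = -z i) :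
      ∑ i, B.ballInertia i * (c' i * s i + B.delta ^ 2 * (x i + z i)
          - (1 - B.eps) * (B.delta * c i * g i))
        + ∑ i, B.mass i * (B.dist ^ 2 * ((1 - B.eps) ^ 2 * (x i + z i))) =
      B.delta ^ 2 * ∑ i, (B.ballInertia i + B.mass i * B.r ^ 2) * x i
        - (B.delta ^ 2 * ∑ i, (B.ballInertia i + B.mass i * B.r ^ 2) * z' i
        + (1 - B.eps) * (B.delta * ∑ i, B.ballInertia i * c i * g i))
        + ∑ i, B.ballInertia i * (c' i * s i) := by
    simp only [Finset.mul_sum, ← Finset.sum_add_distrib, ← Finset.sum_sub_distrib]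
    refine Finset.sum_congr rfl fun i _ => ?_
    rw [hz]
    linear_combination B.mass i * (x i + z i) * B.dist_sq_mul
  have h := key (fun i => (a - ((Γ i ⬝ᵥ Ω) • Γ' i + (Γ i ⬝ᵥ a + Γ' i ⬝ᵥ Ω) • Γ i)) ⬝ᵥ η)
    (fun i => (Ω ⨯₃ (Ω - (Γ i ⬝ᵥ Ω) • Γ i)) ⬝ᵥ η) (fun i => ((Ω - (Γ i ⬝ᵥ Ω) • Γ i) ⨯₃ Ω) ⬝ᵥ η)
    (fun i => (Γ i ⨯₃ Ω) ⬝ᵥ η) (fun i => by rw [← cross_anticomm, neg_dotProduct])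
  linear_combination h

theorem Bearing.hasDerivAt_bodyDir (B : Bearing n) {q : ℝ → Conf n} {v : Conf n} {t : ℝ}
    (hQ : q t ∈ Q n) (hv : v ∈ B.distribution (q t)) (hq : HasDerivAt q v t) (i : Fin n) :
    HasDerivAt (fun s => bodyDir (q s) i) (B.eps • (bodyDir (q t) i ⨯₃ bodyAngVel (q t) v)) t := by
  have h := hq.fst_comp.m3_transpose.m3_mulVec (hasDerivAt_pi.1 hq.snd_comp.snd_comp i)
  convert! h using 1
  have h2 : v.2.2 i = (1 - B.eps) • ((q t).1 *ᵥ (bodyAngVel (q t) v ⨯₃ bodyDir (q t) i)) :=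
    congrFun (congrArg (fun v : Conf n => v.2.2) (B.eq_rollingVel hQ hv)) i
  rw [vel_eq_mul_hat hQ hv.1, h2, Matrix.transpose_mul, ← Matrix.mulVec_mulVec, hat_transpose,
    Matrix.neg_mulVec, hat_mulVec, Matrix.mulVec_smul, SO3_transpose_mulVec hQ.1, ← bodyDir,
    ← cross_anticomm (bodyAngVel (q t) v)]
  module

/-- The Lagrange derivative of the energy at a virtual displacement. The coefficients of `η` give
the equation of `M`, the coefficients of `s i` the conservation of the spin `⟨ωᵢ, γᵢ⟩`. -/
theorem Bearing.eulerLagrange_rollingVel (B : Bearing n) {q : ℝ → Conf n} {J : Set ℝ} {t : ℝ}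
    (hJ : IsOpen J) (ht : t ∈ J) (hph : ∀ s ∈ J, (q s, deriv q s) ∈ B.phase)
    (hq : DifferentiableAt ℝ q t) (s : Fin n → ℝ) (η : V3) {a : V3} {c' : Fin n → ℝ}
    (ha : HasDerivAt (fun u => bodyAngVel (q u) (deriv q u)) a t)
    (hc : ∀ i, HasDerivAt (fun u => ballAngVel (q u) (deriv q u) i ⬝ᵥ (q u).2.2 i) (c' i) t) :
    eulerLagrange B.energy q t (B.rollingVel s η (q t)) =
      (B.momentumRate (bodyAngVel (q t) (deriv q t)) (bodyDir (q t)) a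
          (fun i => B.eps • (bodyDir (q t) i ⨯₃ bodyAngVel (q t) (deriv q t)))
        - (B.momentum (bodyAngVel (q t) (deriv q t)) (bodyDir (q t)) ⨯₃
            bodyAngVel (q t) (deriv q t)
          + (1 - B.eps) • (B.gyro (fun i => ballAngVel (q t) (deriv q t) i ⬝ᵥ (q t).2.2 i)
            (bodyDir (q t)) ⨯₃ bodyAngVel (q t) (deriv q t)))) ⬝ᵥ η
      + ∑ i, B.ballInertia i * (c' i * s i) := by
  have hQ : q t ∈ Q n := (hph t ht).1
  have hv : deriv q t ∈ B.distribution (q t) := (hph t ht).2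
  have hg : HasDerivAt (fun u => (q u).1) ((q t).1 * hat (bodyAngVel (q t) (deriv q t))) t := by
    convert! hq.hasDerivAt.fst_comp using 1
    exact (vel_eq_mul_hat hQ hv.1).symm
  have hΓ := B.hasDerivAt_bodyDir hQ hv hq.hasDerivAt
  rw [← B.sum_ball_contributions _ c' s _ a η (bodyDir (q t)) _ (bodyDir_mem hQ) fun i => rfl]
  set Ω := bodyAngVel (q t) (deriv q t) with hΩ
  set Γ := bodyDir (q t) with hΓt
  set Γ' : Fin n → V3 := fun i => B.eps • (Γ i ⨯₃ Ω)
  set c : Fin n → ℝ := fun i => ballAngVel (q t) (deriv q t) i ⬝ᵥ (q t).2.2 i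
  have hb (i : Fin n) : HasDerivAt (fun u => ballAngVel (q u) (deriv q u) i)
      ((q t).1 *ᵥ ((c i • Γ' i + c' i • Γ i + B.delta • a - ((B.delta * (Γ i ⬝ᵥ Ω)) • Γ' i
        + (B.delta * (Γ i ⬝ᵥ a + Γ' i ⬝ᵥ Ω)) • Γ i)) + Ω ⨯₃ B.ballOmega c Ω Γ i)) t := by
    have h1 := (((hc i).fun_smul (hΓ i)).fun_add (ha.fun_const_smul B.delta)).fun_sub
      ((((hΓ i).v3_dot ha).const_mul B.delta).fun_smul (hΓ i))
    refine (hasDerivAt_frame_mulVec hg h1).congr_of_eventuallyEq ?_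
    filter_upwards [hJ.mem_nhds ht] with u hu
    have h2 := B.ballAngVel_rollingVel (fun i => ballAngVel (q u) (deriv q u) i ⬝ᵥ (q u).2.2 i)
      (bodyAngVel (q u) (deriv q u)) (hph u hu).1 i
    rw [← B.eq_rollingVel (hph u hu).1 (hph u hu).2] at h2
    exact h2
  have hd (i : Fin n) : HasDerivAt (fun u => (deriv q u).2.2 i)
      ((1 - B.eps) • ((q t).1 *ᵥ ((a ⨯₃ Γ i + Ω ⨯₃ Γ' i) + Ω ⨯₃ (Ω ⨯₃ Γ i)))) t := by
    rw [add_comm (a ⨯₃ Γ i)]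
    refine ((hasDerivAt_frame_mulVec hg (ha.v3_cross (hΓ i))).fun_const_smul
      (1 - B.eps)).congr_of_eventuallyEq ?_
    filter_upwards [hJ.mem_nhds ht] with u hu
    exact congrFun (congrArg (fun v : Conf n => v.2.2)
      (B.eq_rollingVel (hph u hu).1 (hph u hu).2)) i
  rw [B.eulerLagrange_energy hQ hv.1 (B.rollingVel_mem_tangentQ s η hQ) hq ha hb hd,
    B.bodyAngVel_rollingVel s η hQ]
  simp only [B.ballAngVel_rollingVel s η hQ, SO3_dot hQ.1]
  congr 1
  refine Finset.sum_congr rfl fun i _ => ?_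
  rw [Bearing.rollingVel, smul_dotProduct, dotProduct_smul, SO3_dot hQ.1, smul_eq_mul, smul_eq_mul,
    pow_two (1 - B.eps), ← mul_assoc (1 - B.eps)]

/-! ### The reduced vector field -/

section

variable {E : Type*} [NormedAddCommGroup E] [NormedSpace ℝ E] {k : WithTop ℕ∞} {x : E} {f : E → M3}

theorem _root_.ContDiffAt.m3_entry (hf : ContDiffAt ℝ k f x) (i j : Fin 3) :
    ContDiffAt ℝ k (fun y => f y i j) x :=
  contDiffAt_pi.1 (contDiffAt_pi.1 (show ContDiffAt ℝ k (fun y i j => f y i j) x from hf) i) j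

@[fun_prop]
theorem _root_.ContDiffAt.m3_det (hf : ContDiffAt ℝ k f x) :
    ContDiffAt ℝ k (fun y => (f y).det) x := by
  have h := hf.m3_entry
  simp only [Matrix.det_fin_three]
  fun_prop

@[fun_prop]
theorem _root_.ContDiffAt.m3_adjugate (hf : ContDiffAt ℝ k f x) :
    ContDiffAt ℝ k (fun y => (f y).adjugate) x := by
  have h := hf.m3_entry
  refine contDiffAt_pi.2 fun i => contDiffAt_pi.2 fun j => ?_
  simp only [Matrix.adjugate_fin_three]
  fin_cases i <;> fin_cases j <;> simp <;> fun_prop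

end

/-- The modified operator of inertia `𝐈 = diag(A, B, C) + δ² ∑ (Iᵢ + mᵢ r²) prᵢ`. -/
noncomputable def Bearing.inertiaMatrix (B : Bearing n) (Γ : Fin n → V3) : M3 :=
  Matrix.diagonal B.inertia + B.delta ^ 2 • ∑ i, (B.ballInertia i + B.mass i * B.r ^ 2) •
    (1 - Matrix.vecMulVec (Γ i) (Γ i))

theorem Bearing.momentum_eq (B : Bearing n) (Ω : V3) (Γ : Fin n → V3) :
    B.momentum Ω Γ = B.inertiaMatrix Γ *ᵥ Ω := by
  rw [momentum, inertiaMatrix, Matrix.add_mulVec, Matrix.smul_mulVec, Matrix.sum_mulVec]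
  congr 1
  · funext k
    rw [Matrix.mulVec_diagonal]
  · congr 1
    refine Finset.sum_congr rfl fun i _ => ?_
    rw [Matrix.smul_mulVec, Matrix.sub_mulVec, Matrix.one_mulVec, Matrix.vecMulVec_mulVec]
    simp

/-- `𝐈` is positive definite. -/
theorem Bearing.inertiaMatrix_det_ne (B : Bearing n) {Γ : Fin n → V3} (hΓ : ∀ i, Γ i ∈ S2) :
    (B.inertiaMatrix Γ).det ≠ 0 := by
  intro h0
  obtain ⟨a, ha, h⟩ := Matrix.exists_mulVec_eq_zero_iff.2 h0
  have h1 : a ⬝ᵥ B.momentum a Γ = 0 := by rw [B.momentum_eq, h, dotProduct_zero]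
  rw [momentum, dotProduct_add, dotProduct_smul, dotProduct_sum] at h1
  have h2 : 0 ≤ ∑ i, a ⬝ᵥ ((B.ballInertia i + B.mass i * B.r ^ 2) • (a - (Γ i ⬝ᵥ a) • Γ i)) := by
    refine Finset.sum_nonneg fun i _ => ?_
    have hk : 0 ≤ B.ballInertia i + B.mass i * B.r ^ 2 := by
      have := B.ballInertia_pos i
      have := B.mass_pos i
      positivity
    rw [dotProduct_smul, smul_eq_mul]
    refine mul_nonneg hk ?_
    -- Lagrange's identity: `|a|² - ⟨Γ, a⟩² = |Γ × a|²`
    have h3 := cross_dot_cross (Γ i) a (Γ i) a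
    rw [show Γ i ⬝ᵥ Γ i = 1 from hΓ i] at h3
    have h4 : 0 ≤ (Γ i ⨯₃ a) ⬝ᵥ (Γ i ⨯₃ a) :=
      Finset.sum_nonneg fun _ _ => mul_self_nonneg _
    rw [h3] at h4
    rw [dotProduct_sub, dotProduct_smul, smul_eq_mul]
    linarith [dotProduct_comm a (Γ i), mul_comm (Γ i ⬝ᵥ a) (a ⬝ᵥ Γ i)]
  have h5 : 0 < a ⬝ᵥ (fun k => B.inertia k * a k) := by
    obtain ⟨k, hk⟩ := Function.ne_iff.1 ha
    refine Finset.sum_pos' (fun j _ => ?_) ⟨k, Finset.mem_univ k, ?_⟩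
    · nlinarith [B.inertia_pos j, mul_nonneg (B.inertia_pos j).le (mul_self_nonneg (a j))]
    · have := mul_pos (B.inertia_pos k) (mul_self_pos.2 hk)
      linarith [mul_left_comm (a k) (B.inertia k) (a k)]
  have h6 := mul_nonneg (sq_nonneg B.delta) h2
  rw [smul_eq_mul] at h1
  linarith

/-- The solution `Ω` of `𝐈 Ω = m`, by Cramer's rule. -/
noncomputable def Bearing.velOfMomentum (B : Bearing n) (m : V3) (Γ : Fin n → V3) : V3 :=
  (B.inertiaMatrix Γ).det⁻¹ • ((B.inertiaMatrix Γ).adjugate *ᵥ m)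

theorem Bearing.momentum_velOfMomentum (B : Bearing n) (m : V3) {Γ : Fin n → V3}
    (hΓ : ∀ i, Γ i ∈ S2) : B.momentum (B.velOfMomentum m Γ) Γ = m := by
  rw [momentum_eq, velOfMomentum, Matrix.mulVec_smul, Matrix.mulVec_mulVec, Matrix.mul_adjugate,
    Matrix.smul_mulVec, Matrix.one_mulVec, smul_smul, inv_mul_cancel₀ (B.inertiaMatrix_det_ne hΓ),
    one_smul]

theorem Bearing.velOfMomentum_momentum (B : Bearing n) (Ω : V3) {Γ : Fin n → V3}
    (hΓ : ∀ i, Γ i ∈ S2) : B.velOfMomentum (B.momentum Ω Γ) Γ = Ω := by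
  rw [momentum_eq, velOfMomentum, Matrix.mulVec_mulVec, Matrix.adjugate_mul,
    Matrix.smul_mulVec, Matrix.one_mulVec, smul_smul, inv_mul_cancel₀ (B.inertiaMatrix_det_ne hΓ),
    one_smul]

theorem Bearing.contDiffAt_velOfMomentum (B : Bearing n) {y : Red n} (hy : y ∈ redSpace n) :
    ContDiffAt ℝ ∞ (fun y : Red n => B.velOfMomentum y.1 y.2) y := by
  have h : ContDiffAt ℝ ∞ (fun y : Red n => B.inertiaMatrix y.2) y := by
    refine contDiffAt_pi.2 fun i => contDiffAt_pi.2 fun j => ?_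
    simp only [inertiaMatrix, Matrix.add_apply, Matrix.smul_apply, Matrix.sum_apply,
      Matrix.sub_apply, Matrix.vecMulVec_apply]
    fun_prop
  unfold velOfMomentum
  exact (h.m3_det.inv (B.inertiaMatrix_det_ne hy)).smul (h.m3_adjugate.m3_mulVec contDiffAt_fst)

/-- The time derivative of `M` along the reduced system. -/
noncomputable def Bearing.torque (B : Bearing n) (c : Fin n → ℝ) (y : Red n) : V3 :=
  B.momentum y.1 y.2 ⨯₃ y.1 + (1 - B.eps) • (B.gyro c y.2 ⨯₃ y.1)

/-- The vector field of the reduced system: the equation of `M`, solved for the derivative of `Ω`,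
and the equation of `Γ`. -/
noncomputable def Bearing.reducedField (B : Bearing n) (c : Fin n → ℝ) (y : Red n) : Red n :=
  (B.velOfMomentum (B.torque c y
      - B.momentumRate y.1 y.2 0 (fun i => B.eps • (y.2 i ⨯₃ y.1))) y.2,
    fun i => B.eps • (y.2 i ⨯₃ y.1))

theorem Bearing.contDiffAt_reducedField (B : Bearing n) (c : Fin n → ℝ) {y : Red n}
    (hy : y ∈ redSpace n) : ContDiffAt ℝ ∞ (B.reducedField c) y := by
  have h : ContDiffAt ℝ ∞ (fun y : Red n => B.torque c y
      - B.momentumRate y.1 y.2 0 (fun i => B.eps • (y.2 i ⨯₃ y.1))) y := by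
    unfold torque momentumRate momentum gyro
    fun_prop
  have hv := (B.contDiffAt_velOfMomentum (y := (B.torque c y
    - B.momentumRate y.1 y.2 0 (fun i => B.eps • (y.2 i ⨯₃ y.1)), y.2)) hy).comp y
    (h.prodMk contDiffAt_snd)
  exact hv.prodMk (by fun_prop)

theorem Bearing.momentumRate_eq (B : Bearing n) (Ω : V3) (Γ : Fin n → V3) (a : V3)
    (Γ' : Fin n → V3) :
    B.momentumRate Ω Γ a Γ' = B.momentum a Γ + B.momentumRate Ω Γ 0 Γ' := by
  unfold momentumRate momentum
  rw [add_add_add_comm, ← smul_add, ← Finset.sum_add_distrib]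
  congr 1
  · funext k; simp
  · congr 1
    refine Finset.sum_congr rfl fun i _ => ?_
    rw [dotProduct_zero]
    module

theorem Bearing.solvesReduced_iff (B : Bearing n) (c : Fin n → ℝ) {J : Set ℝ} {y : ℝ → Red n}
    (hJ : IsOpen J) (hy : ∀ t ∈ J, y t ∈ redSpace n) :
    B.SolvesReduced c J y ↔ ∀ t ∈ J, HasDerivAt y (B.reducedField c (y t)) t := by
  constructor
  · intro h t ht
    obtain ⟨hM, hΓ⟩ := h t ht
    have hΓ' : HasDerivAt (fun s => (y s).2) (fun i => B.eps • ((y t).2 i ⨯₃ (y t).1)) t :=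
      hasDerivAt_pi.2 hΓ
    -- `Ω` is differentiable because `M` and `Γ` are and `𝐈` is invertible.
    have hΩ : DifferentiableAt ℝ (fun s => (y s).1) t := by
      have h1 : DifferentiableAt ℝ (fun s => B.velOfMomentum (B.momentum (y s).1 (y s).2) (y s).2)
          t := by
        have h2 := (B.contDiffAt_velOfMomentum (y := (B.momentum (y t).1 (y t).2, (y t).2))
          (hy t ht)).differentiableAt (by simp)
        exact h2.comp t (hM.differentiableAt.prodMk hΓ'.differentiableAt)
      refine h1.congr_of_eventuallyEq ?_
      filter_upwards [hJ.mem_nhds ht] with s hs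
      exact (B.velOfMomentum_momentum _ (hy s hs)).symm
    have h3 := (B.hasDerivAt_momentum hΩ.hasDerivAt hΓ).unique hM
    rw [B.momentumRate_eq, ← eq_sub_iff_add_eq] at h3
    have h4 := B.velOfMomentum_momentum (deriv (fun s => (y s).1) t) (hy t ht)
    rw [h3] at h4
    have h5 := hΩ.hasDerivAt.prodMk hΓ'
    rw [← h4] at h5
    exact h5
  · intro h t ht
    have hΓ := hasDerivAt_pi.1 (h t ht).snd_comp
    refine ⟨?_, hΓ⟩
    have h1 := B.hasDerivAt_momentum (h t ht).fst_comp hΓ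
    rw [B.momentumRate_eq] at h1
    convert! h1 using 1
    have h2 := B.momentum_velOfMomentum (B.torque c (y t)
      - B.momentumRate (y t).1 (y t).2 0 (fun i => B.eps • ((y t).2 i ⨯₃ (y t).1))) (hy t ht)
    simp only [reducedField]
    rw [h2, sub_add_cancel]
    rfl

/-! ### Reconstruction of rotations from angular velocities -/

theorem eq_of_hasDerivAt_zero {E : Type*} [NormedAddCommGroup E] [NormedSpace ℝ E] {J : Set ℝ}
    {f : ℝ → E} (hJ : IsOpen J) (hJ' : J.OrdConnected) (hf : ∀ t ∈ J, HasDerivAt f 0 t) {t₀ t : ℝ}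
    (h₀ : t₀ ∈ J) (ht : t ∈ J) : f t = f t₀ :=
  hJ.is_const_of_deriv_eq_zero hJ'.isPreconnected
    (fun s hs => (hf s hs).differentiableAt.differentiableWithinAt) (fun s hs => (hf s hs).deriv)
    ht h₀

theorem exists_bilin_bound {F G H : Type*} [NormedAddCommGroup F] [NormedSpace ℝ F]
    [FiniteDimensional ℝ F] [NormedAddCommGroup G] [NormedSpace ℝ G] [FiniteDimensional ℝ G]
    [NormedAddCommGroup H] [NormedSpace ℝ H] (b : F →ₗ[ℝ] G →ₗ[ℝ] H) :
    ∃ m : ℝ, 0 < m ∧ ∀ x y, ‖b x y‖ ≤ m * ‖x‖ * ‖y‖ :=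
  b.toContinuousBilinearMap.isBoundedBilinearMap.bound

/-- If `G` and `H` solve `X' = φ X Â`, then `G Hᵀ` is constant. For `G = H` this says that rotations
remain rotations, in general it is the uniqueness of the solution. -/
theorem mul_transpose_const {J : Set ℝ} {A : ℝ → V3} {G H : ℝ → M3} {φ : ℝ → ℝ} (hJ : IsOpen J)
    (hJ' : J.OrdConnected) (hG : ∀ t ∈ J, HasDerivAt G (φ t • (G t * hat (A t))) t)
    (hH : ∀ t ∈ J, HasDerivAt H (φ t • (H t * hat (A t))) t) {t₀ t : ℝ} (h₀ : t₀ ∈ J)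
    (ht : t ∈ J) : G t * (H t)ᵀ = G t₀ * (H t₀)ᵀ := by
  refine eq_of_hasDerivAt_zero (f := fun s => G s * (H s)ᵀ) hJ hJ' (fun s hs => ?_) h₀ ht
  convert! (hG s hs).m3_mul (hH s hs).m3_transpose using 1
  rw [Matrix.transpose_smul, Matrix.transpose_mul, hat_transpose]
  simp [mul_assoc]

theorem mem_SO3_of_continuousOn {J : Set ℝ} {G : ℝ → M3} (hJ : J.OrdConnected)
    (hG : ContinuousOn G J) (h : ∀ t ∈ J, G t * (G t)ᵀ = 1) {t₀ t : ℝ} (h₀ : t₀ ∈ J) (ht : t ∈ J)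
    (hd : (G t₀).det = 1) : G t ∈ SO3 := by
  refine mem_SO3.2 ⟨h t ht, ?_⟩
  rw [← hd]
  refine hJ.isPreconnected.constant_of_mapsTo (T := {1, -1}) (Set.toFinite _).isDiscrete
    (f := fun s => (G s).det) ?_ ?_ ht h₀
  · exact continuous_id.matrix_det.comp_continuousOn hG
  · intro s hs
    have h1 := congrArg Matrix.det (h s hs)
    rw [Matrix.det_mul, Matrix.det_transpose, Matrix.det_one] at h1
    exact mul_self_eq_one_iff.1 h1

theorem norm_le_one_of_mul_transpose {g : M3} (hg : g * gᵀ = 1) : ‖g‖ ≤ 1 := by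
  refine entrywise_sup_norm_bound_of_unitary ?_
  rw [Matrix.mem_unitaryGroup_iff]
  exact hg

/-- The equation `G' = G Â` is solved on a compact interval by the Picard-Lindelöf theorem for the
equation `G' = φ(G) G Â` with a cutoff function `φ`. The cutoff does not affect that `G Gᵀ` is
constant, and `φ = 1` on the rotations. -/
theorem exists_rotation_Ioo {a b t₀ : ℝ} (h₀ : t₀ ∈ Set.Ioo a b) {A : ℝ → V3}
    (hA : ContinuousOn A (Set.Icc a b)) :
    ∃ G : ℝ → M3, G t₀ = 1 ∧ ∀ t ∈ Set.Ioo a b, G t ∈ SO3 ∧ HasDerivAt G (G t * hat (A t)) t := by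
  let φ : ContDiffBump (0 : M3) := ⟨1, 2, one_pos, one_lt_two⟩
  let F : M3 → M3 := fun X => φ X • X
  have hF : ContDiff ℝ 1 F := φ.contDiff.smul contDiff_id
  have hFs : HasCompactSupport F := φ.hasCompactSupport.smul_right
  obtain ⟨K, hK⟩ := hF.lipschitzWith_of_hasCompactSupport hFs one_ne_zero
  obtain ⟨C, hC⟩ := hF.continuous.bounded_above_of_compact_support hFs
  have hhat : ContinuousOn (fun t => hat (A t)) (Set.Icc a b) :=
    hatLin.continuous_of_finiteDimensional.comp_continuousOn hA
  obtain ⟨D, hD⟩ := isCompact_Icc.exists_bound_of_continuousOn hhat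
  obtain ⟨m, hm0, hm⟩ := exists_bilin_bound (LinearMap.mul ℝ M3)
  simp only [LinearMap.mul_apply'] at hm
  have hC0 : 0 ≤ C := (norm_nonneg _).trans (hC 0)
  have hD0 : 0 ≤ D := (norm_nonneg _).trans (hD t₀ ⟨h₀.1.le, h₀.2.le⟩)
  have hT : 0 ≤ max (b - t₀) (t₀ - a) := le_max_of_le_left (by linarith [h₀.2])
  have hPL : IsPicardLindelof (fun t X => F X * hat (A t)) (tmin := a) (tmax := b)
      ⟨t₀, h₀.1.le, h₀.2.le⟩ (1 : M3) ((m * C * D).toNNReal * (max (b - t₀) (t₀ - a)).toNNReal) 0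
      (m * C * D).toNNReal ((m * D).toNNReal * K) := by
    refine ⟨fun t ht => LipschitzOnWith.of_dist_le_mul fun X _ Y _ => ?_, fun X _ => ?_,
      fun t ht X _ => ?_, ?_⟩
    · rw [dist_eq_norm, ← sub_mul]
      have h1 := hK.dist_le_mul X Y
      rw [dist_eq_norm] at h1
      calc ‖(F X - F Y) * hat (A t)‖ ≤ m * ‖F X - F Y‖ * ‖hat (A t)‖ := hm _ _
        _ ≤ m * (K * dist X Y) * D := by gcongr; exact hD t ht
        _ = _ := by
            rw [NNReal.coe_mul, Real.coe_toNNReal _ (by positivity)]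
            ring
    · exact (continuous_const.matrix_mul continuous_id).comp_continuousOn hhat
    · calc ‖F X * hat (A t)‖ ≤ m * ‖F X‖ * ‖hat (A t)‖ := hm _ _
        _ ≤ m * C * D := by gcongr; exacts [hC X, hD t ht]
        _ = _ := (Real.coe_toNNReal _ (by positivity)).symm
    · rw [NNReal.coe_zero, sub_zero, NNReal.coe_mul, Real.coe_toNNReal _ hT]
  obtain ⟨G, hG0, hG⟩ := hPL.exists_eq_forall_mem_Icc_hasDerivWithinAt₀
  have hG' : ∀ t ∈ Set.Ioo a b, HasDerivAt G (φ (G t) • (G t * hat (A t))) t := by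
    intro t ht
    rw [← smul_mul_assoc]
    exact (hG t ⟨ht.1.le, ht.2.le⟩).hasDerivAt (Icc_mem_nhds ht.1 ht.2)
  have h1 : ∀ t ∈ Set.Ioo a b, G t * (G t)ᵀ = 1 := by
    intro t ht
    rw [mul_transpose_const isOpen_Ioo Set.ordConnected_Ioo hG' hG' h₀ ht, hG0]
    simp
  refine ⟨G, hG0, fun t ht => ⟨?_, ?_⟩⟩
  · refine mem_SO3_of_continuousOn Set.ordConnected_Ioo
      (fun s hs => (hG' s hs).continuousAt.continuousWithinAt) h1 h₀ ht ?_
    simp only at hG0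
    rw [hG0, Matrix.det_one]
  · have h2 := hG' t ht
    have h3 : φ (G t) = 1 := φ.one_of_mem_closedBall
      (mem_closedBall_zero_iff.2 (norm_le_one_of_mul_transpose (h1 t ht)))
    rwa [h3, one_smul] at h2

/-- The equation `G' = G Â` has a global solution on every open interval on which `A` is
continuous. -/
theorem exists_rotation {J : Set ℝ} (hJ : IsOpen J) (hJ' : J.OrdConnected) {A : ℝ → V3}
    (hA : ContinuousOn A J) {t₀ : ℝ} (h₀ : t₀ ∈ J) :
    ∃ G : ℝ → M3, ∀ t ∈ J, G t ∈ SO3 ∧ HasDerivAt G (G t * hat (A t)) t := by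
  have hnb (t : ℝ) (ht : t ∈ J) : ∃ a b, t ∈ Set.Ioo a b ∧ Set.Icc a b ⊆ J := by
    obtain ⟨ε, hε, h⟩ := Metric.isOpen_iff.1 hJ t ht
    refine ⟨t - ε / 2, t + ε / 2, ⟨by linarith, by linarith⟩, fun s hs => h ?_⟩
    rw [Metric.mem_ball, Real.dist_eq, abs_lt]
    exact ⟨by linarith [hs.1], by linarith [hs.2]⟩
  have hloc (t : ℝ) (ht : t ∈ J) : ∃ a b, ∃ H : ℝ → M3, t ∈ Set.Ioo a b ∧ t₀ ∈ Set.Ioo a b ∧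
      Set.Ioo a b ⊆ J ∧ H t₀ = 1 ∧
      ∀ s ∈ Set.Ioo a b, H s ∈ SO3 ∧ HasDerivAt H (H s * hat (A s)) s := by
    obtain ⟨a, b, hab, hJab⟩ := hnb t ht
    obtain ⟨a', b', hab', hJab'⟩ := hnb t₀ h₀
    have hsub : Set.Icc (min a a') (max b b') ⊆ J := by
      refine hJ'.out ?_ ?_
      · rcases min_choice a a' with h | h <;> rw [h]
        exacts [hJab ⟨le_rfl, (hab.1.trans hab.2).le⟩, hJab' ⟨le_rfl, (hab'.1.trans hab'.2).le⟩]
      · rcases max_choice b b' with h | h <;> rw [h]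
        exacts [hJab ⟨(hab.1.trans hab.2).le, le_rfl⟩, hJab' ⟨(hab'.1.trans hab'.2).le, le_rfl⟩]
    have h0 : t₀ ∈ Set.Ioo (min a a') (max b b') :=
      ⟨min_lt_of_right_lt hab'.1, lt_max_of_lt_right hab'.2⟩
    obtain ⟨H, hH0, hH⟩ := exists_rotation_Ioo h0 (hA.mono hsub)
    exact ⟨_, _, H, ⟨min_lt_of_left_lt hab.1, lt_max_of_lt_left hab.2⟩, h0,
      Set.Ioo_subset_Icc_self.trans hsub, hH0, hH⟩
  choose! a b H hta ht₀ hsub hH0 hH using hloc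
  -- Solutions with the same value at `t₀` agree where both are defined.
  have hagree (s t : ℝ) (hs : s ∈ J) (ht : t ∈ J) (hst : s ∈ Set.Ioo (a t) (b t)) :
      H s s = H t s := by
    have h1 : ∀ u ∈ Set.Ioo (a s) (b s) ∩ Set.Ioo (a t) (b t),
        HasDerivAt (H s) ((1 : ℝ) • (H s u * hat (A u))) u := fun u hu => by
      rw [one_smul]; exact (hH s hs u hu.1).2
    have h2 : ∀ u ∈ Set.Ioo (a s) (b s) ∩ Set.Ioo (a t) (b t),
        HasDerivAt (H t) ((1 : ℝ) • (H t u * hat (A u))) u := fun u hu => by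
      rw [one_smul]; exact (hH t ht u hu.2).2
    have h3 := mul_transpose_const (φ := fun _ => 1) (isOpen_Ioo.inter isOpen_Ioo)
      (Set.ordConnected_Ioo.inter Set.ordConnected_Ioo) h1 h2 ⟨ht₀ s hs, ht₀ t ht⟩ ⟨hta s hs, hst⟩
    rw [hH0 s hs, hH0 t ht, Matrix.transpose_one, one_mul] at h3
    calc H s s = (H s s * (H t s)ᵀ) * H t s := by
          rw [mul_assoc, SO3_transpose_mul (hH t ht s hst).1, mul_one]
      _ = H t s := by rw [h3, one_mul]
  refine ⟨fun t => H t t, fun t ht => ⟨(hH t ht t (hta t ht)).1, ?_⟩⟩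
  refine (hH t ht t (hta t ht)).2.congr_of_eventuallyEq ?_
  filter_upwards [isOpen_Ioo.mem_nhds (hta t ht)] with s hs
  exact hagree s t (hsub t ht hs) ht hs

/-! ### Coordinates on `𝒟_c` -/

/-- The point of `𝒟_c` with the coordinates `z`. -/
noncomputable def Bearing.phasePoint (B : Bearing n) (c : Fin n → ℝ) (z : Coord n) :
    Conf n × Conf n :=
  (confOf z, B.rollingVel c z.1 (confOf z))

theorem confOf_mem {z : Coord n} (hz : z ∈ coordSpace n) : confOf z ∈ Q n :=
  ⟨hz.1, hz.2.1, fun i => SO3_mem_S2 hz.1 (hz.2.2 i)⟩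

theorem bodyDir_confOf {z : Coord n} (hz : z ∈ coordSpace n) : bodyDir (confOf z) = z.2.2.2 :=
  funext fun i => SO3_transpose_mulVec hz.1 (z.2.2.2 i)

theorem Bearing.rollingVel_mem_phaseC (B : Bearing n) (c : Fin n → ℝ) (Ω : V3) {q : Conf n}
    (hq : q ∈ Q n) : (q, B.rollingVel c Ω q) ∈ B.phaseC c :=
  ⟨⟨hq, B.rollingVel_mem_distribution c Ω hq⟩, B.ballSpin_rollingVel c Ω hq⟩

theorem Bearing.vel_eq_rollingVel (B : Bearing n) {c : Fin n → ℝ} {q v : Conf n}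
    (h : (q, v) ∈ B.phaseC c) : v = B.rollingVel c (bodyAngVel q v) q := by
  have h1 := B.eq_rollingVel h.1.1 h.1.2
  have h2 : (fun i => ballAngVel q v i ⬝ᵥ q.2.2 i) = c := funext h.2
  simp only at h1
  rwa [h2] at h1

theorem Bearing.coords_phasePoint (B : Bearing n) (c : Fin n → ℝ) {z : Coord n}
    (hz : z ∈ coordSpace n) : coords (B.phasePoint c z) = z :=
  Prod.ext (B.bodyAngVel_rollingVel c z.1 (confOf_mem hz))
    (Prod.ext rfl (Prod.ext rfl (bodyDir_confOf hz)))

theorem coords_mem {q v : Conf n} (hq : q ∈ Q n) : coords (q, v) ∈ coordSpace n :=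
  ⟨hq.1, hq.2.1, bodyDir_mem hq⟩

theorem confOf_coords {q v : Conf n} (hq : q ∈ Q n) : confOf (coords (q, v)) = q :=
  Prod.ext rfl (Prod.ext rfl (funext fun i => mulVec_bodyDir hq i))

theorem Bearing.phasePoint_coords (B : Bearing n) {c : Fin n → ℝ} {x : Conf n × Conf n}
    (h : x ∈ B.phaseC c) : B.phasePoint c (coords x) = x := by
  obtain ⟨q, v⟩ := x
  rw [phasePoint, confOf_coords h.1.1]
  exact Prod.ext rfl (B.vel_eq_rollingVel h).symm

theorem Bearing.contDiffAt_phasePoint (B : Bearing n) (c : Fin n → ℝ) (z : Coord n) :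
    ContDiffAt ℝ ∞ (B.phasePoint c) z := by
  unfold phasePoint rollingVel confOf bodyDir ballOmega
  fun_prop

theorem contDiffAt_coords (x : Conf n × Conf n) : ContDiffAt ℝ ∞ coords x := by
  unfold coords bodyAngVel
  fun_prop

theorem Bearing.isDiffeo_coords (B : Bearing n) (c : Fin n → ℝ) :
    IsDiffeo coords (B.phaseC c) (coordSpace n) :=
  ⟨fun x hx => ⟨coords_mem hx.1.1, contDiffAt_coords x⟩, B.phasePoint c,
    fun z hz => ⟨B.rollingVel_mem_phaseC c z.1 (confOf_mem hz), B.contDiffAt_phasePoint c z,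
      B.coords_phasePoint c hz⟩, fun _ hx => B.phasePoint_coords hx⟩

/-! ### The motions -/

section

variable {B : Bearing n} {J : Set ℝ} {q : ℝ → Conf n} {t : ℝ}

theorem Bearing.IsMotion.hasDerivAt_bodyAngVel (hm : B.IsMotion J q) (ht : t ∈ J) :
    HasDerivAt (fun u => bodyAngVel (q u) (deriv q u))
      (bodyAngVel (q t) (deriv (deriv q) t) + bodyAngVel (deriv q t) (deriv q t)) t :=
  BallBearing.hasDerivAt_bodyAngVel (hm t ht).1.hasDerivAt (hm t ht).2.1.hasDerivAt

theorem Bearing.IsMotion.hasDerivAt_spin (hm : B.IsMotion J q) (ht : t ∈ J) (i : Fin n) :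
    HasDerivAt (fun u => ballAngVel (q u) (deriv q u) i ⬝ᵥ (q u).2.2 i)
      (deriv (fun u => ballAngVel (q u) (deriv q u) i ⬝ᵥ (q u).2.2 i) t) t :=
  ((hasDerivAt_ballAngVel (hm t ht).1.hasDerivAt (hm t ht).2.1.hasDerivAt i).v3_dot
    (hasDerivAt_pi.1 (hm t ht).1.hasDerivAt.snd_comp.snd_comp i)).differentiableAt.hasDerivAt

/-- The virtual displacement in which a ball spins about `γᵢ` does not move the contact points, so
that the spin of the ball is preserved. -/
theorem Bearing.IsMotion.hasDerivAt_spin_zero (hJ : IsOpen J) (hm : B.IsMotion J q) (ht : t ∈ J)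
    (i : Fin n) : HasDerivAt (fun u => ballAngVel (q u) (deriv q u) i ⬝ᵥ (q u).2.2 i) 0 t := by
  have hQ : q t ∈ Q n := (hm t ht).2.2.1.1
  have h := (hm t ht).2.2.2 _ (B.rollingVel_mem_distribution (Pi.single i 1) 0 hQ)
  rw [B.eulerLagrange_rollingVel hJ ht (fun s hs => (hm s hs).2.2.1) (hm t ht).1 _ _
    (hm.hasDerivAt_bodyAngVel ht) (hm.hasDerivAt_spin ht), dotProduct_zero, zero_add,
    Finset.sum_eq_single_of_mem i (Finset.mem_univ i)
      (fun j _ hj => by rw [Pi.single_eq_of_ne hj, mul_zero, mul_zero]), Pi.single_eq_same,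
    mul_one] at h
  have h1 := hm.hasDerivAt_spin ht i
  rwa [(mul_eq_zero.1 h).resolve_left (B.ballInertia_pos i).ne'] at h1

/-- The equation of `M` consists of the coefficients of the angular velocity `η` of the moving
sphere in the virtual displacements. -/
theorem Bearing.IsMotion.momentumRate_eq (hJ : IsOpen J) (hm : B.IsMotion J q) (ht : t ∈ J) :
    B.momentumRate (bodyAngVel (q t) (deriv q t)) (bodyDir (q t))
        (bodyAngVel (q t) (deriv (deriv q) t) + bodyAngVel (deriv q t) (deriv q t))
        (fun i => B.eps • (bodyDir (q t) i ⨯₃ bodyAngVel (q t) (deriv q t))) =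
      B.momentum (bodyAngVel (q t) (deriv q t)) (bodyDir (q t)) ⨯₃ bodyAngVel (q t) (deriv q t)
        + (1 - B.eps) • (B.gyro (fun i => ballAngVel (q t) (deriv q t) i ⬝ᵥ (q t).2.2 i)
          (bodyDir (q t)) ⨯₃ bodyAngVel (q t) (deriv q t)) := by
  have hQ : q t ∈ Q n := (hm t ht).2.2.1.1
  have h (η : V3) := (B.eulerLagrange_rollingVel hJ ht (fun s hs => (hm s hs).2.2.1) (hm t ht).1
    0 η (hm.hasDerivAt_bodyAngVel ht) (hm.hasDerivAt_spin ht)).symm.trans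
      ((hm t ht).2.2.2 _ (B.rollingVel_mem_distribution 0 η hQ))
  simp only [Pi.zero_apply, mul_zero, Finset.sum_const_zero, add_zero] at h
  exact sub_eq_zero.1 (dotProduct_self_eq_zero.1 (h _))

theorem Bearing.IsMotion.mem_phaseC (hJ : IsOpen J) (hJ' : J.OrdConnected) (hm : B.IsMotion J q)
    {c : Fin n → ℝ} {t₀ : ℝ} (h₀ : t₀ ∈ J) (h : (q t₀, deriv q t₀) ∈ B.phaseC c) (ht : t ∈ J) :
    (q t, deriv q t) ∈ B.phaseC c :=
  ⟨(hm t ht).2.2.1, fun i => (eq_of_hasDerivAt_zero hJ hJ'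
    (fun _ hs => hm.hasDerivAt_spin_zero hJ hs i) h₀ ht).trans (h.2 i)⟩

theorem Bearing.SolvesReduced.congr {c : Fin n → ℝ} {y y' : ℝ → Red n} (hJ : IsOpen J)
    (h : B.SolvesReduced c J y) (hy : ∀ t ∈ J, y' t = y t) : B.SolvesReduced c J y' := by
  intro t ht
  have he : y' =ᶠ[nhds t] y := Filter.eventually_of_mem (hJ.mem_nhds ht) hy
  rw [hy t ht]
  exact ⟨(h t ht).1.congr_of_eventuallyEq (he.fun_comp fun y => B.momentum y.1 y.2),
    fun i => ((h t ht).2 i).congr_of_eventuallyEq (he.fun_comp fun y => y.2 i)⟩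

/-- The motions in `𝒟_c` solve the complete system. -/
theorem Bearing.IsMotion.solvesComplete {c : Fin n → ℝ} {z : ℝ → Coord n} (hJ : IsOpen J)
    (hm : B.IsMotion J q)
    (hz : ∀ t ∈ J, (q t, deriv q t) ∈ B.phaseC c ∧ z t = coords (q t, deriv q t)) :
    B.SolvesComplete c J z := by
  refine ⟨Bearing.SolvesReduced.congr
    (y := fun t => (bodyAngVel (q t) (deriv q t), bodyDir (q t))) hJ (fun t ht => ?_)
    (fun t ht => by rw [(hz t ht).2]; rfl), fun t ht => ?_⟩
  · have hph := (hm t ht).2.2.1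
    have hΓ := B.hasDerivAt_bodyDir hph.1 hph.2 (hm t ht).1.hasDerivAt
    refine ⟨?_, hΓ⟩
    have h := B.hasDerivAt_momentum (Γ := fun s => bodyDir (q s)) (hm.hasDerivAt_bodyAngVel ht) hΓ
    rw [hm.momentumRate_eq hJ ht] at h
    have hc : (fun i => ballAngVel (q t) (deriv q t) i ⬝ᵥ (q t).2.2 i) = c := funext (hz t ht).1.2
    rw [hc] at h
    exact h
  · have hq : HasDerivAt q (B.rollingVel c (bodyAngVel (q t) (deriv q t)) (q t)) t := by
      convert! (hm t ht).1.hasDerivAt using 1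
      exact (B.vel_eq_rollingVel (hz t ht).1).symm
    have he : z =ᶠ[nhds t] fun s => coords (q s, deriv q s) :=
      Filter.eventually_of_mem (hJ.mem_nhds ht) fun s hs => (hz s hs).2
    rw [(hz t ht).2]
    exact ⟨hq.fst_comp.congr_of_eventuallyEq (he.fun_comp fun z => z.2.1),
      fun i => (hasDerivAt_pi.1 hq.snd_comp.fst_comp i).congr_of_eventuallyEq
        (he.fun_comp fun z => z.2.2.1 i)⟩

theorem Bearing.SolvesComplete.exists_hasDerivAt {c : Fin n → ℝ} {z : ℝ → Coord n}
    (hJ : IsOpen J) (hz : ∀ t ∈ J, z t ∈ coordSpace n) (h : B.SolvesComplete c J z) (ht : t ∈ J) :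
    ∃ z' : Coord n, HasDerivAt z z' t :=
  have hy := (B.solvesReduced_iff c (y := fun s => ((z s).1, (z s).2.2.2)) hJ
    fun s hs => (hz s hs).2.2).1 h.1 t ht
  ⟨_, hy.fst_comp.prodMk ((h.2 t ht).1.prodMk
    ((hasDerivAt_pi.2 (h.2 t ht).2).prodMk hy.snd_comp))⟩

/-- The equation of `Γᵢ` and the reconstruction equations say that the velocity satisfies the
constraints. -/
theorem Bearing.SolvesComplete.hasDerivAt_conf {c : Fin n → ℝ} {z : ℝ → Coord n} (hJ : IsOpen J)
    (hz : ∀ t ∈ J, z t ∈ coordSpace n ∧ q t = confOf (z t)) (h : B.SolvesComplete c J z)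
    (ht : t ∈ J) : HasDerivAt q (B.phasePoint c (z t)).2 t := by
  have he : q =ᶠ[nhds t] fun s => confOf (z s) :=
    Filter.eventually_of_mem (hJ.mem_nhds ht) fun s hs => (hz s hs).2
  refine HasDerivAt.congr_of_eventuallyEq ?_ he
  have hzt := (hz t ht).1
  refine (h.2 t ht).1.prodMk ((hasDerivAt_pi.2 fun i => ?_).prodMk (hasDerivAt_pi.2 fun i => ?_))
  · rw [bodyDir_confOf hzt]
    exact (h.2 t ht).2 i
  · rw [bodyDir_confOf hzt]
    convert! hasDerivAt_frame_mulVec (h.2 t ht).1 ((h.1 t ht).2 i) using 1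
    simp only [confOf]
    rw [← Matrix.mulVec_smul, ← cross_anticomm (z t).1]
    congr 1
    module

/-- The solutions of the complete system are motions. -/
theorem Bearing.SolvesComplete.isMotion {c : Fin n → ℝ} {z : ℝ → Coord n} (hJ : IsOpen J)
    (hz : ∀ t ∈ J, z t ∈ coordSpace n ∧ q t = confOf (z t)) (h : B.SolvesComplete c J z) :
    B.IsMotion J q ∧ ∀ t ∈ J, (q t, deriv q t) ∈ B.phaseC c ∧ z t = coords (q t, deriv q t) := by
  have hpt : ∀ t ∈ J, (q t, deriv q t) = B.phasePoint c (z t) := fun t ht =>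
    Prod.ext (hz t ht).2 (h.hasDerivAt_conf hJ hz ht).deriv
  have hC : ∀ t ∈ J, (q t, deriv q t) ∈ B.phaseC c := fun t ht => by
    rw [hpt t ht]
    exact B.rollingVel_mem_phaseC c _ (confOf_mem (hz t ht).1)
  have hco : ∀ t ∈ J, z t = coords (q t, deriv q t) := fun t ht => by
    rw [hpt t ht, B.coords_phasePoint c (hz t ht).1]
  refine ⟨fun t ht => ?_, fun t ht => ⟨hC t ht, hco t ht⟩⟩
  obtain ⟨z', hz'⟩ := h.exists_hasDerivAt hJ (fun s hs => (hz s hs).1) ht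
  have hq := (h.hasDerivAt_conf hJ hz ht).differentiableAt
  refine ⟨hq, ?_, (hC t ht).1, fun w hw => ?_⟩
  · have h1 : DifferentiableAt ℝ (fun s => (B.phasePoint c (z s)).2) t :=
      ((B.contDiffAt_phasePoint c (z t)).snd.differentiableAt (by simp)).comp t hz'.differentiableAt
    refine h1.congr_of_eventuallyEq ?_
    filter_upwards [hJ.mem_nhds ht] with s hs
    exact (h.hasDerivAt_conf hJ hz hs).deriv
  · have ha : HasDerivAt (fun u => bodyAngVel (q u) (deriv q u)) z'.1 t := by
      refine hz'.fst_comp.congr_of_eventuallyEq ?_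
      filter_upwards [hJ.mem_nhds ht] with s hs
      rw [hco s hs]
      rfl
    have hc (i : Fin n) :
        HasDerivAt (fun u => ballAngVel (q u) (deriv q u) i ⬝ᵥ (q u).2.2 i) 0 t := by
      refine (hasDerivAt_const t (c i)).congr_of_eventuallyEq ?_
      filter_upwards [hJ.mem_nhds ht] with s hs
      exact (hC s hs).2 i
    rw [B.eq_rollingVel (hC t ht).1.1 hw, B.eulerLagrange_rollingVel hJ ht
      (fun s hs => (hC s hs).1) hq _ _ ha hc]
    have h2 := (B.hasDerivAt_momentum (Γ := fun s => (z s).2.2.2) hz'.fst_comp (h.1 t ht).2).unique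
      (h.1 t ht).1
    have hz1 : (z t).1 = bodyAngVel (q t) (deriv q t) := by rw [hco t ht]; rfl
    have hz2 : (z t).2.2.2 = bodyDir (q t) := by rw [hco t ht]; rfl
    simp only [hz1, hz2] at h2
    have hc' : (fun i => ballAngVel (q t) (deriv q t) i ⬝ᵥ (q t).2.2 i) = c := funext (hC t ht).2
    rw [hc', sub_eq_zero.2 h2]
    simp

end

/-! ### Reduction by `SO(3)^{n+1}` -/

/-- The point of `TQ` over `(g, (hᵢ))` whose projection to `(TQ)/SO(3)^{n+1}` is `y`. -/
noncomputable def quotLift (g : M3) (h : Fin n → M3) (y : Quot1 n) : Conf n × Conf n :=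
  ((g, h, fun i => g *ᵥ y.2.2.2 i),
    (g * hat y.1, fun i => hat (g *ᵥ y.2.1 i) * h i,
      fun i => g *ᵥ (y.2.2.1 i + y.1 ⨯₃ y.2.2.2 i)))

theorem quotMap_quotLift {g : M3} {h : Fin n → M3} (hg : g ∈ SO3) (hh : ∀ i, h i ∈ SO3)
    (y : Quot1 n) : quotMap (quotLift g h y) = y := by
  refine Prod.ext ?_ (Prod.ext (funext fun i => ?_) (Prod.ext (funext fun i => ?_)
    (funext fun i => ?_)))
  · simp only [quotMap, quotLift, bodyAngVel]
    rw [← mul_assoc, SO3_transpose_mul hg, one_mul, vee_hat]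
  · simp only [quotMap, quotLift, ballAngVel]
    rw [mul_assoc, SO3_mul_transpose (hh i), mul_one, vee_hat, SO3_transpose_mulVec hg]
  · simp only [quotMap, quotLift]
    rw [SO3_transpose_mulVec hg, Matrix.transpose_mul, ← Matrix.mulVec_mulVec,
      SO3_transpose_mulVec hg, hat_transpose, Matrix.neg_mulVec, hat_mulVec]
    abel
  · exact SO3_transpose_mulVec hg _

theorem transpose_vel_mulVec {q v : Conf n} (hq : q ∈ Q n) (hv : v ∈ tangentQ q) (x : V3) :
    v.1ᵀ *ᵥ x = -(bodyAngVel q v ⨯₃ (q.1ᵀ *ᵥ x)) := by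
  conv_lhs => rw [vel_eq_mul_hat hq hv]
  rw [Matrix.transpose_mul, ← Matrix.mulVec_mulVec, hat_transpose, Matrix.neg_mulVec, hat_mulVec]

theorem quotLift_quotMap {x : Conf n × Conf n} (hx : x ∈ TQ n) :
    quotLift x.1.1 x.1.2.1 (quotMap x) = x := by
  obtain ⟨q, v⟩ := x
  have hq : q ∈ Q n := hx.1
  have hv : v ∈ tangentQ q := hx.2
  refine Prod.ext (Prod.ext rfl (Prod.ext rfl (funext fun i => mulVec_bodyDir hq i)))
    (Prod.ext (vel_eq_mul_hat hq hv).symm (Prod.ext (funext fun i => ?_) (funext fun i => ?_)))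
  · simp only [quotMap, quotLift]
    rw [SO3_mulVec_transpose hq.1, ← ballVel_eq_hat_mul hq hv]
  · simp only [quotMap, quotLift]
    rw [transpose_vel_mulVec hq hv, neg_add_cancel_right, SO3_mulVec_transpose hq.1]

theorem act_quotLift {a g : M3} (ha : a ∈ SO3) (b h : Fin n → M3) (y : Quot1 n) :
    (act a b (quotLift g h y).1, act a b (quotLift g h y).2) =
      quotLift (a * g) (fun i => a * h i * (b i)ᵀ) y := by
  refine Prod.ext (Prod.ext rfl (Prod.ext rfl (funext fun i => ?_)))
    (Prod.ext ?_ (Prod.ext (funext fun i => ?_) (funext fun i => ?_)))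
  · simp only [act, quotLift]
    rw [Matrix.mulVec_mulVec]
  · exact (mul_assoc _ _ _).symm
  · simp only [quotLift, act]
    rw [← Matrix.mulVec_mulVec, hat_mulVec_SO3 ha]
    calc a * (hat (g *ᵥ y.2.1 i) * h i) * (b i)ᵀ
        = a * hat (g *ᵥ y.2.1 i) * (1 * h i) * (b i)ᵀ := by rw [one_mul]; simp only [mul_assoc]
      _ = _ := by rw [← SO3_transpose_mul ha]; simp only [mul_assoc]
  · simp only [act, quotLift]
    rw [Matrix.mulVec_mulVec]

theorem act_eq_quotLift {x : Conf n × Conf n} (hx : x ∈ TQ n) {a : M3} (ha : a ∈ SO3)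
    (b : Fin n → M3) : (act a b x.1, act a b x.2) =
      quotLift (a * x.1.1) (fun i => a * x.1.2.1 i * (b i)ᵀ) (quotMap x) := by
  have h := act_quotLift (g := x.1.1) ha b x.1.2.1 (quotMap x)
  rwa [quotLift_quotMap hx] at h

theorem quotMap_image (n : ℕ) : quotMap '' TQ n = quotSpace n := by
  ext y
  constructor
  · rintro ⟨⟨q, v⟩, ⟨hq, hv⟩, rfl⟩ i
    have hQ : q ∈ Q n := hq
    have hV : v ∈ tangentQ q := hv
    refine ⟨bodyDir_mem hQ i, ?_⟩
    simp only [quotMap]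
    rw [transpose_vel_mulVec hQ hV, dotProduct_add, SO3_dot (SO3_transpose hQ.1), hV.2.2 i,
      dotProduct_neg, dot_cross_self]
    simp
  · intro hy
    refine ⟨quotLift 1 (fun _ => 1) y, ⟨⟨SO3_one, fun _ => SO3_one, fun i => ?_⟩, ?_, fun i => ?_,
      fun i => ?_⟩, quotMap_quotLift SO3_one (fun _ => SO3_one) y⟩
    · exact SO3_mem_S2 SO3_one (hy i).1
    · simp [quotLift, hat_transpose]
    · simp [quotLift, hat_transpose]
    · simp only [quotLift, Matrix.one_mulVec]
      rw [dotProduct_add, (hy i).2, dot_cross_self, add_zero]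

theorem quotMap_eq_iff {x y : Conf n × Conf n} (hx : x ∈ TQ n) (hy : y ∈ TQ n) :
    quotMap x = quotMap y ↔ SameOrbit x y := by
  constructor
  · intro h
    have ha : y.1.1 * x.1.1ᵀ ∈ SO3 := SO3_mul hy.1.1 (SO3_transpose hx.1.1)
    refine ⟨y.1.1 * x.1.1ᵀ, ha, fun i => (y.1.2.1 i)ᵀ * (y.1.1 * x.1.1ᵀ) * x.1.2.1 i,
      fun i => SO3_mul (SO3_mul (SO3_transpose (hy.1.2.1 i)) ha) (hx.1.2.1 i), ?_⟩
    rw [act_eq_quotLift hx ha, h]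
    conv_lhs => rw [← quotLift_quotMap hy]
    congr 1
    · rw [mul_assoc, SO3_transpose_mul hx.1.1, mul_one]
    · funext i
      have h1 := SO3_mul_transpose (SO3_mul ha (hx.1.2.1 i))
      rw [mul_assoc (y.1.2.1 i)ᵀ, Matrix.transpose_mul (y.1.2.1 i)ᵀ, Matrix.transpose_transpose,
        ← mul_assoc, h1, one_mul]
  · rintro ⟨a, ha, b, hb, rfl⟩
    rw [act_eq_quotLift hx ha, quotMap_quotLift (SO3_mul ha hx.1.1) fun i =>
      SO3_mul (SO3_mul ha (hx.1.2.1 i)) (SO3_transpose (hb i))]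

theorem act_mem {a : M3} {b : Fin n → M3} (ha : a ∈ SO3) (hb : ∀ i, b i ∈ SO3) {q : Conf n}
    (hq : q ∈ Q n) : act a b q ∈ Q n :=
  ⟨SO3_mul ha hq.1, fun i => SO3_mul (SO3_mul ha (hq.2.1 i)) (SO3_transpose (hb i)),
    fun i => SO3_mem_S2 ha (hq.2.2 i)⟩

theorem bodyDir_act {a : M3} (ha : a ∈ SO3) (b : Fin n → M3) (q : Conf n) :
    bodyDir (act a b q) = bodyDir q := by
  funext i
  simp only [bodyDir, act]
  rw [Matrix.transpose_mul, ← Matrix.mulVec_mulVec, SO3_transpose_mulVec ha]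

theorem Bearing.act_rollingVel (B : Bearing n) (c : Fin n → ℝ) (Ω : V3) {a : M3} (ha : a ∈ SO3)
    (b : Fin n → M3) (q : Conf n) :
    act a b (B.rollingVel c Ω q) = B.rollingVel c Ω (act a b q) := by
  simp only [rollingVel, bodyDir_act ha]
  refine Prod.ext (mul_assoc _ _ _).symm (Prod.ext (funext fun i => ?_) (funext fun i => ?_))
  · simp only [act]
    rw [Matrix.transpose_mul]
    calc _ = a * q.1 * hat (B.ballOmega c Ω (bodyDir q) i) * q.1ᵀ * (1 * q.2.1 i) * (b i)ᵀ := by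
          rw [one_mul]; simp only [mul_assoc]
      _ = _ := by rw [← SO3_transpose_mul ha]; simp only [mul_assoc]
  · simp only [act]
    rw [Matrix.mulVec_smul, Matrix.mulVec_mulVec]

theorem Bearing.mem_phaseC_of_sameOrbit (B : Bearing n) {c : Fin n → ℝ} {x y : Conf n × Conf n}
    (hx : x ∈ B.phaseC c) (h : SameOrbit x y) : y ∈ B.phaseC c := by
  obtain ⟨a, ha, b, hb, rfl⟩ := h
  obtain ⟨q, v⟩ := x
  have h1 := B.act_rollingVel c (bodyAngVel q v) ha b q
  rw [← B.vel_eq_rollingVel hx] at h1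
  simp only [h1]
  exact B.rollingVel_mem_phaseC c _ (act_mem ha hb hx.1.1)

/-- The point of `ℳ_c` over the point `(Ω, (Γᵢ))` of `𝒩`. -/
noncomputable def Bearing.redPoint (B : Bearing n) (c : Fin n → ℝ) (y : Red n) : Quot1 n :=
  (y.1, B.ballOmega c y.1 y.2, fun i => B.eps • (y.2 i ⨯₃ y.1), y.2)

theorem Bearing.quotMap_rollingVel (B : Bearing n) (c : Fin n → ℝ) (Ω : V3) {q : Conf n}
    (hq : q ∈ Q n) : quotMap (q, B.rollingVel c Ω q) = B.redPoint c (Ω, bodyDir q) := by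
  have h : (q, B.rollingVel c Ω q) = quotLift q.1 q.2.1 (B.redPoint c (Ω, bodyDir q)) := by
    refine Prod.ext (Prod.ext rfl (Prod.ext rfl (funext fun i => (mulVec_bodyDir hq i).symm)))
      (Prod.ext rfl (Prod.ext (funext fun i => ?_) (funext fun i => ?_)))
    · simp only [quotLift, redPoint, rollingVel]
      rw [hat_mulVec_SO3 hq.1]
    · simp only [quotLift, redPoint, rollingVel]
      rw [← Matrix.mulVec_smul, ← cross_anticomm Ω]
      congr 1
      module
  rw [h, quotMap_quotLift hq.1 hq.2.1]

theorem Bearing.quotMap_eq_redPoint (B : Bearing n) {c : Fin n → ℝ} {q v : Conf n}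
    (h : (q, v) ∈ B.phaseC c) : quotMap (q, v) = B.redPoint c (bodyAngVel q v, bodyDir q) := by
  rw [← B.quotMap_rollingVel c _ h.1.1, ← B.vel_eq_rollingVel h]

theorem Bearing.redPhaseC_eq (B : Bearing n) (c : Fin n → ℝ) :
    B.redPhaseC c = B.redPoint c '' redSpace n := by
  ext y
  constructor
  · rintro ⟨⟨q, v⟩, hx, rfl⟩
    refine ⟨(bodyAngVel q v, bodyDir q), bodyDir_mem hx.1.1, ?_⟩
    rw [B.quotMap_eq_redPoint hx]
  · rintro ⟨y, hy, rfl⟩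
    have hz : ((y.1, 1, fun _ => 1, y.2) : Coord n) ∈ coordSpace n :=
      ⟨SO3_one, fun _ => SO3_one, hy⟩
    refine ⟨_, B.rollingVel_mem_phaseC c y.1 (confOf_mem hz), ?_⟩
    rw [B.quotMap_rollingVel c _ (confOf_mem hz), bodyDir_confOf hz]

theorem Bearing.isDiffeo_proj (B : Bearing n) (c : Fin n → ℝ) :
    IsDiffeo proj (B.redPhaseC c) (redSpace n) := by
  rw [B.redPhaseC_eq c]
  refine ⟨?_, B.redPoint c, fun y hy => ⟨⟨y, hy, rfl⟩, ?_, rfl⟩, ?_⟩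
  · rintro _ ⟨y, hy, rfl⟩
    refine ⟨hy, ?_⟩
    unfold proj
    fun_prop
  · unfold redPoint ballOmega
    fun_prop
  · rintro _ ⟨y, hy, rfl⟩
    rfl

/-- Every solution of the reduced system is the projection of a motion: the rotations are recovered
from their angular velocities. -/
theorem Bearing.SolvesReduced.exists_motion {B : Bearing n} {c : Fin n → ℝ} {J : Set ℝ}
    {y : ℝ → Quot1 n} (hJ : IsOpen J) (hJ' : J.OrdConnected) (hy : ∀ t ∈ J, y t ∈ B.redPhaseC c)
    (h : B.SolvesReduced c J (fun t => proj (y t))) :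
    ∃ q : ℝ → Conf n, B.IsMotion J q ∧
      ∀ t ∈ J, (q t, deriv q t) ∈ B.phaseC c ∧ y t = quotMap (q t, deriv q t) := by
  rcases J.eq_empty_or_nonempty with rfl | ⟨t₀, h₀⟩
  · exact ⟨fun _ => 0, by simp [IsMotion], by simp⟩
  rw [B.redPhaseC_eq c] at hy
  have hN : ∀ t ∈ J, proj (y t) ∈ redSpace n := by
    intro t ht
    obtain ⟨u, hu, h1⟩ := hy t ht
    rw [← h1]
    exact hu
  have hd := (B.solvesReduced_iff c hJ hN).1 h
  have hΩ : ContinuousOn (fun t => (y t).1) J := fun t ht =>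
    (hd t ht).fst_comp.continuousAt.continuousWithinAt
  have hΓ : ContinuousOn (fun t => (y t).2.2.2) J := fun t ht =>
    (hd t ht).snd_comp.continuousAt.continuousWithinAt
  obtain ⟨g, hg⟩ := exists_rotation hJ hJ' hΩ h₀
  have hgc : ContinuousOn g J := fun t ht => (hg t ht).2.continuousAt.continuousWithinAt
  -- The transpose of `gᵢ` solves an equation of the same form as `g`.
  have hball (i : Fin n) : ∃ G : ℝ → M3, ∀ t ∈ J, G t ∈ SO3 ∧ HasDerivAt G
      (G t * hat (-(g t *ᵥ B.ballOmega c (y t).1 (y t).2.2.2 i))) t := by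
    refine exists_rotation hJ hJ' ?_ h₀
    have h1 : ContinuousOn (fun t => B.ballOmega c (y t).1 (y t).2.2.2 i) J := by
      have h2 : Continuous fun z : V3 × (Fin n → V3) => B.ballOmega c z.1 z.2 i := by
        refine ContDiff.continuous (𝕜 := ℝ) (n := ∞) (contDiff_iff_contDiffAt.2 fun z => ?_)
        unfold ballOmega
        fun_prop
      exact h2.comp_continuousOn (hΩ.prodMk hΓ)
    exact ((continuous_fst.matrix_mulVec continuous_snd).comp_continuousOn (hgc.prodMk h1)).neg
  choose G hG using hball
  let z : ℝ → Coord n := fun t => ((y t).1, g t, fun i => (G i t)ᵀ, (y t).2.2.2)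
  have hz : ∀ t ∈ J, z t ∈ coordSpace n := fun t ht =>
    ⟨(hg t ht).1, fun i => SO3_transpose (hG i t ht).1, hN t ht⟩
  have hs : B.SolvesComplete c J z := by
    refine ⟨h, fun t ht => ⟨(hg t ht).2, fun i => ?_⟩⟩
    convert! (hG i t ht).2.m3_transpose using 1
    rw [Matrix.transpose_mul, hat_transpose, hat_neg, neg_neg, hat_mulVec_SO3 (hg t ht).1]
  obtain ⟨hm, hq⟩ := hs.isMotion (q := fun t => confOf (z t)) hJ fun t ht => ⟨hz t ht, rfl⟩
  refine ⟨_, hm, fun t ht => ⟨(hq t ht).1, ?_⟩⟩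
  obtain ⟨u, hu, h1⟩ := hy t ht
  have h2 : B.redPoint c (proj (y t)) = y t := by rw [← h1]; rfl
  have h3 : (z t).1 = bodyAngVel (confOf (z t)) (deriv (fun t => confOf (z t)) t) :=
    congrArg Prod.fst (hq t ht).2
  rw [B.quotMap_eq_redPoint (hq t ht).1, ← h3, bodyDir_confOf (hz t ht)]
  exact h2.symm

end BallBearing

theorem theorem1 {n : ℕ} (B : Bearing n) (c : Fin n → ℝ) :
    -- `𝒟_c` is invariant: a motion that starts in it remains in it
    (∀ (J : Set ℝ) (q : ℝ → Conf n), IsOpen J → J.OrdConnected → B.IsMotion J q →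
      ∀ t₀ ∈ J, (q t₀, deriv q t₀) ∈ B.phaseC c → ∀ t ∈ J, (q t, deriv q t) ∈ B.phaseC c) ∧
    -- (i) `(Ω, g, gᵢ, Γᵢ)` are global coordinates on `𝒟_c`, and in them the motions in `𝒟_c` are
    -- exactly the solutions of the complete system
    IsDiffeo coords (B.phaseC c) (coordSpace n) ∧
    (∀ (J : Set ℝ) (q : ℝ → Conf n) (z : ℝ → Coord n), IsOpen J → J.OrdConnected →
      ((B.IsMotion J q ∧
          ∀ t ∈ J, (q t, deriv q t) ∈ B.phaseC c ∧ z t = coords (q t, deriv q t)) ↔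
        ((∀ t ∈ J, z t ∈ coordSpace n ∧ q t = confOf (z t)) ∧ B.SolvesComplete c J z))) ∧
    -- (ii) `quotMap` is the quotient map of `TQ` by `SO(3)^{n+1}`, and `𝒟_c` is invariant under
    -- the action, so that `ℳ_c = 𝒟_c / SO(3)^{n+1}`
    quotMap '' TQ n = quotSpace n ∧
    (∀ x ∈ TQ n, ∀ y ∈ TQ n, quotMap x = quotMap y ↔ SameOrbit x y) ∧
    (∀ x ∈ B.phaseC c, ∀ y, SameOrbit x y → y ∈ B.phaseC c) ∧
    -- `ℳ_c` is diffeomorphic to `𝒩`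
    IsDiffeo proj (B.redPhaseC c) (redSpace n) ∧
    -- the curves in `ℳ_c` under the motions in `𝒟_c` are exactly the solutions of the reduced system
    (∀ (J : Set ℝ) (y : ℝ → Quot1 n), IsOpen J → J.OrdConnected →
      ((∃ q : ℝ → Conf n, B.IsMotion J q ∧
          ∀ t ∈ J, (q t, deriv q t) ∈ B.phaseC c ∧ y t = quotMap (q t, deriv q t)) ↔
        ((∀ t ∈ J, y t ∈ B.redPhaseC c) ∧ B.SolvesReduced c J (fun t => proj (y t))))) ∧
    -- the reduced system is closed: it is the system of a smooth vector field on `𝒩`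
    (∃ X : Red n → Red n,
      (∀ y ∈ redSpace n, ContDiffAt ℝ ∞ X y ∧ ∀ i, y.2 i ⬝ᵥ (X y).2 i = 0) ∧
      ∀ (J : Set ℝ) (y : ℝ → Red n), IsOpen J → (∀ t ∈ J, y t ∈ redSpace n) →
        (B.SolvesReduced c J y ↔ ∀ t ∈ J, HasDerivAt y (X (y t)) t)) := by
  refine ⟨fun J q hJ hJ' hm t₀ h₀ h t ht => hm.mem_phaseC hJ hJ' h₀ h ht, B.isDiffeo_coords c,
    fun J q z hJ _ => ⟨fun h => ⟨fun t ht => ?_, h.1.solvesComplete hJ h.2⟩,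
      fun h => h.2.isMotion hJ h.1⟩,
    quotMap_image n, fun x hx y hy => quotMap_eq_iff hx hy,
    fun x hx y h => B.mem_phaseC_of_sameOrbit hx h, B.isDiffeo_proj c,
    fun J y hJ hJ' => ⟨?_, fun h => h.2.exists_motion hJ hJ' h.1⟩,
    B.reducedField c, fun y hy => ⟨B.contDiffAt_reducedField c hy, fun i => ?_⟩,
    fun J y hJ hy => B.solvesReduced_iff c hJ hy⟩
  · obtain ⟨hC, hz⟩ := h.2 t ht
    rw [hz]
    exact ⟨coords_mem hC.1.1, (confOf_coords hC.1.1).symm⟩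
  · rintro ⟨q, hm, h⟩
    refine ⟨fun t ht => ?_, Bearing.SolvesReduced.congr hJ
      (hm.solvesComplete (z := fun t => coords (q t, deriv q t)) hJ
        fun t ht => ⟨(h t ht).1, rfl⟩).1 fun t ht => ?_⟩
    · rw [(h t ht).2]
      exact Set.mem_image_of_mem _ (h t ht).1
    · rw [(h t ht).2]
      rfl
  · simp only [Bearing.reducedField]
    rw [dotProduct_smul, dot_self_cross, smul_zero]
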